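/- Let $T:X\to X$ be a map of a set. A closed orbit of length $n\ge 1$ is a set $\{x,Tx,\dots,T^{n}x=x\}$ of cardinality $n$; let $\mathsf O_T(n)$ be the number of closed orbits of length $n$, assume $\mathsf O_T(n)<\infty$ for all $n\ge1$, and let $\mathsf d_T(s)=\sum_{n\ge1}\mathsf O_T(n)n^{-s}$ be the orbit Dirichlet series of $T$. Then $\mathsf d_T(s)=\zeta(s)$ for all $\Re(s)>1$ if and only if $\mathsf O_T(n)=1$ for every $n\ge1$. Suppose that this is the case. Then the Cartesian cube $T\times T\times T$ on $X^3$ also has only finitely many closed orbits of each length, and the following hold. 1. The Dirichlet series $\mathsf d_{T\times T\times T}(s)$ has abscissa of convergence $3$. 2. For $\Re(s)>3$ the series $\mathsf d_{T\times T\times T}(s)$ converges absolutely, the product below over all primes $p$ converges (independently of the order of its factors), and $$\mathsf d_{T\times T\times T}(s)=\zeta(s)\,\zeta(s-1)\,\zeta(s-2)\prod_{p}\bigl(1+(2p+2)p^{-s}+p^{1-2s}\bigr).$$ 3. $\mathsf d_{T\times T\times T}$ extends to a meromorphic function $F$ on the half-plane $\Re(s)>1$. 4. The line $\Re(s)=1$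 is a natural boundary for $F$: there are no point $z$ with $\Re(z)=1$, open neighbourhood $U$ of $z$ and meromorphic function $g$ on $U$ such that $g$ and $F$ agree as meromorphic functions on $U\cap\{\Re(s)>1\}$. -/

import Mathlib

/-- The closed orbits of length `n` of a map `T`: the sets of the form
`{x, T x, …, T^n x = x}` of cardinality `n`. (There are none for `n = 0`.) -/
def closedOrbits {X : Type*} (T : X → X) (n : ℕ) : Set (Set X) :=
  {τ | ∃ x : X, T^[n] x = x ∧ τ = (fun k : ℕ => T^[k] x) '' Set.Iic n ∧ τ.ncard = n}

/-- The number `O_T(n)` of closed orbits of length `n` of `T` (meaningful when this is finite). -/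
noncomputable def orbitCount {X : Type*} (T : X → X) (n : ℕ) : ℕ :=
  (closedOrbits T n).ncard

/-- The coefficients of the orbit Dirichlet series of `T`. -/
noncomputable def orbitCoeff {X : Type*} (T : X → X) (n : ℕ) : ℂ :=
  (orbitCount T n : ℂ)

/-- The orbit Dirichlet series `d_T(s) = ∑_{n ≥ 1} O_T(n) / n ^ s`. -/
noncomputable def orbitDirichletSeries {X : Type*} (T : X → X) (s : ℂ) : ℂ :=
  LSeries (orbitCoeff T) s

/-- The Dirichlet series `∑_{n ≥ 1} f n / n ^ s` converges at `s`, as a limit of its partial sums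
(not necessarily absolutely). -/
def DirichletConvergesAt (f : ℕ → ℂ) (s : ℂ) : Prop :=
  ∃ l : ℂ, Filter.Tendsto (fun N : ℕ => ∑ n ∈ Finset.Icc 1 N, f n / (n : ℂ) ^ s)
    Filter.atTop (nhds l)

/-- The abscissa of convergence of the Dirichlet series `∑_{n ≥ 1} f n / n ^ s`: the infimum, in
the extended reals, of the real parts of the points at which it converges. -/
noncomputable def abscissaOfConvergence (f : ℕ → ℂ) : EReal :=
  sInf ((fun s : ℂ => ((s.re : ℝ) : EReal)) '' {s : ℂ | DirichletConvergesAt f s})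

/-- The line `Re s = a` is a natural boundary for the function `F`, meromorphic on `Re s > a`:
for no point `z` of the line is there a meromorphic function `g` on an open neighbourhood `U` of
`z` that agrees with `F` on `U ∩ {Re s > a}` (up to a discrete set of points, since values of
meromorphic functions at their poles carry no meaning). -/
def HasNaturalBoundaryAtRe (F : ℂ → ℂ) (a : ℝ) : Prop :=
  ∀ z : ℂ, z.re = a → ∀ U : Set ℂ, IsOpen U → z ∈ U → ∀ g : ℂ → ℂ, MeromorphicOn g U →
    ¬ F =ᶠ[Filter.codiscreteWithin (U ∩ {s : ℂ | a < s.re})] g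

/-- The factor `1 + (2p + 2) p^{-s} + p^{1 - 2s}` of the Euler product. -/
noncomputable def cubeEulerFactor (s : ℂ) (p : Nat.Primes) : ℂ :=
  1 + (2 * ((p : ℕ) : ℂ) + 2) * ((p : ℕ) : ℂ) ^ (-s) + ((p : ℕ) : ℂ) ^ (1 - 2 * s)

/-- The Cartesian cube `T × T × T`. -/
def cartesianCube {X : Type*} (T : X → X) : X × X × X → X × X × X :=
  fun x => (T x.1, T x.2.1, T x.2.2)

/-!
Suppose `T` has exactly one closed orbit of each length. The points fixed by `T^n` number `σ(n)`, so
those fixed by `(T × T × T)^n` number `σ(n) ^ 3`, and Möbius inversion determines the number `a(n)`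
of closed orbits of length `n` of the cube: `∑_{d ∣ n} d a(d) = σ(n) ^ 3`. Hence `a` is
multiplicative, `n ^ 2 ≤ a(n) = O(n ^ (2 + ε))`, and `a(p ^ k)` is a combination of geometric
progressions in `k`, which sum to the asserted Euler factor
(`tsum_term_prime_pow_of_sum_mul_eq_sigma_cube`). The lower bound for `a` shows that the abscissa of
convergence is `3`: short blocks of terms, on which the phase of `n ^ (-s)` hardly varies, do not
tend to zero when `Re s < 3` (`three_le_re_of_dirichletConvergesAt`).

For the continuation, write `z = p ^ (1 - s)`, so that the Euler factor is
`1 + 2z + (2z + z²) / p` and only `1 + 2z` obstructs convergence in `Re s > 1`. Multiplying `1 + 2z`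
by powers of `1 - z ^ k` or `1 + z ^ k` for `k ≤ K` produces a polynomial `1 + O(z ^ (K + 1))`
(`X_pow_dvd_clearedPoly_sub_one`). The product of the modified factors converges for
`Re s > 1 + 1 / (K + 1)`, and the factors introduced are Euler factors of `ζ (k (s - 1))` and
`ζ (2k (s - 1))`. The functions so obtained for different `K` agree wherever both are given by
convergent products (`cubeContinuation_succ`), and together they are the continuation.

The Euler factor at `p` vanishes at points with `p ^ (s - 1) = -β` and `2 < β ≤ 4`. These
lie within `O(1 / log p)` of any given point of the line `Re s = 1`. Such a zero `s` is a zero of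
the continuation unless `ζ (j (s - 1)) = 0` for some `j ≥ 1`. In that case `ρ = j (s - 1)` is a zero
of `ζ` in the critical strip of height `O(j)`, `Re ρ < 1` forces `p > 2 ^ j`, and `p` is determined
by `(j, ρ)`. As `ζ` has only `O(t ^ 2)` zeros up to height `t`, by Jensen's inequality for `ξ`
(`exists_ncard_zetaZerosUpTo_le`), the reciprocals of the primes for which this happens have a
finite sum; since `∑ 1 / p` diverges, the zeros of the continuation accumulate at every point of the
line (`exists_cubeEulerFactor_eq_zero_and_riemannZeta_ne_zero`). This is impossible for a nonzero
meromorphic function in a neighbourhood of such a point.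
-/

/-! ### Periodic points and closed orbits of the cube -/

open Function in
theorem image_iterate_Iic_eq_range {X : Type*} {S : X → X} {x : X} {n : ℕ} (hn : 0 < n)
    (hx : IsPeriodicPt S n x) :
    (fun k : ℕ => S^[k] x) '' Set.Iic n = Set.range (fun k : ℕ => S^[k] x) := by
  apply subset_antisymm (Set.image_subset_range _ _)
  rintro _ ⟨k, rfl⟩
  exact ⟨k % n, (Nat.mod_lt k hn).le, hx.iterate_mod_apply k⟩

open Function in
theorem range_iterate_eq_image_Iio {X : Type*} {S : X → X} {x : X}
    (hx : 0 < minimalPeriod S x) :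
    Set.range (fun k : ℕ => S^[k] x) = (fun k : ℕ => S^[k] x) '' Set.Iio (minimalPeriod S x) := by
  apply subset_antisymm _ (Set.image_subset_range _ _)
  rintro _ ⟨k, rfl⟩
  exact ⟨k % minimalPeriod S x, Nat.mod_lt k hx, iterate_mod_minimalPeriod_eq⟩

open Function in
theorem ncard_range_iterate {X : Type*} {S : X → X} {x : X}
    (hx : 0 < minimalPeriod S x) :
    (Set.range (fun k : ℕ => S^[k] x)).ncard = minimalPeriod S x := by
  rw [range_iterate_eq_image_Iio hx, iterate_injOn_Iio_minimalPeriod.ncard_image,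
    Set.ncard_eq_toFinset_card']
  simp

open Function in
theorem finite_range_iterate {X : Type*} {S : X → X} {x : X}
    (hx : 0 < minimalPeriod S x) : (Set.range (fun k : ℕ => S^[k] x)).Finite := by
  rw [range_iterate_eq_image_Iio hx]
  exact (Set.finite_Iio _).image _

open Function in
theorem closedOrbits_eq_image {X : Type*} (S : X → X) {n : ℕ} (hn : 0 < n) :
    closedOrbits S n =
      (fun x => Set.range (fun k : ℕ => S^[k] x)) '' {x | minimalPeriod S x = n} := by
  ext τ
  constructor
  · rintro ⟨x, hx, hτ, hc⟩
    have hx : IsPeriodicPt S n x := hx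
    rw [image_iterate_Iic_eq_range hn hx] at hτ
    refine ⟨x, ?_, hτ.symm⟩
    rw [hτ, ncard_range_iterate (hx.minimalPeriod_pos hn)] at hc
    exact hc
  · rintro ⟨x, rfl, rfl⟩
    refine ⟨x, iterate_minimalPeriod, ?_, ncard_range_iterate hn⟩
    rw [image_iterate_Iic_eq_range hn (isPeriodicPt_minimalPeriod S x)]

open Function in
theorem range_iterate_eq_of_mem {X : Type*} {S : X → X} {x y : X}
    (hx : 0 < minimalPeriod S x) (hy : y ∈ Set.range (fun k : ℕ => S^[k] x)) :
    minimalPeriod S y = minimalPeriod S x ∧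
      Set.range (fun k : ℕ => S^[k] y) = Set.range (fun k : ℕ => S^[k] x) := by
  obtain ⟨k, rfl⟩ := hy
  have h1 : minimalPeriod S (S^[k] x) = minimalPeriod S x :=
    minimalPeriod_apply_iterate (minimalPeriod_pos_iff_mem_periodicPts.1 hx) k
  refine ⟨h1, Set.eq_of_subset_of_ncard_le ?_ ?_ (finite_range_iterate hx)⟩
  · rintro _ ⟨m, rfl⟩
    exact ⟨m + k, iterate_add_apply S m k x⟩
  · rw [ncard_range_iterate hx, ncard_range_iterate (h1 ▸ hx), h1]

open Function in
theorem setOf_minimalPeriod_eq_biUnion {X : Type*} (S : X → X) {n : ℕ} (hn : 0 < n) :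
    {x | minimalPeriod S x = n} = ⋃ τ ∈ closedOrbits S n, τ := by
  rw [closedOrbits_eq_image S hn]
  ext y
  simp only [Set.mem_ofPred_eq, Set.mem_iUnion, Set.mem_image, exists_prop]
  constructor
  · intro hy
    exact ⟨_, ⟨y, hy, rfl⟩, 0, rfl⟩
  · rintro ⟨_, ⟨x, rfl, rfl⟩, hy⟩
    exact (range_iterate_eq_of_mem hn hy).1

open Function in
/-- The points of least period `n` are partitioned into closed orbits of `n` points each. -/
theorem ncard_setOf_minimalPeriod {X : Type*} (S : X → X) {n : ℕ} (hn : 0 < n)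
    (hfin : (closedOrbits S n).Finite) :
    {x | minimalPeriod S x = n}.Finite ∧
      {x | minimalPeriod S x = n}.ncard = n * orbitCount S n := by
  classical
  have hcard : ∀ τ ∈ closedOrbits S n, τ.Finite ∧ τ.ncard = n := by
    rw [closedOrbits_eq_image S hn]
    rintro _ ⟨x, rfl, rfl⟩
    exact ⟨finite_range_iterate hn, ncard_range_iterate hn⟩
  have hf : {x | minimalPeriod S x = n}.Finite := by
    rw [setOf_minimalPeriod_eq_biUnion S hn]
    exact hfin.biUnion fun τ hτ => (hcard τ hτ).1
  refine ⟨hf, ?_⟩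
  have hmaps : Set.MapsTo (fun x => Set.range (fun k : ℕ => S^[k] x)) hf.toFinset
      hfin.toFinset := by
    intro x hx
    simp only [Set.Finite.coe_toFinset] at hx ⊢
    rw [closedOrbits_eq_image S hn]
    exact ⟨x, hx, rfl⟩
  rw [Set.ncard_eq_toFinset_card _ hf, Finset.card_eq_sum_card_fiberwise hmaps]
  rw [Finset.sum_const_nat (m := n), orbitCount, Set.ncard_eq_toFinset_card _ hfin, mul_comm]
  intro τ hτ
  have hτ' : τ ∈ closedOrbits S n := by simpa using hτ
  refine Eq.trans ?_ (hcard τ hτ').2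
  rw [Set.ncard_eq_toFinset_card _ (hcard τ hτ').1]
  congr 1
  rw [closedOrbits_eq_image S hn] at hτ'
  obtain ⟨x, rfl, rfl⟩ := hτ'
  ext y
  simp only [Finset.mem_filter, Set.Finite.mem_toFinset]
  constructor
  · rintro ⟨-, h2⟩
    exact h2 ▸ ⟨0, rfl⟩
  · exact fun hy => range_iterate_eq_of_mem hn hy

open Function in
theorem ptsOfPeriod_eq_biUnion_divisors {X : Type*} (S : X → X) {n : ℕ} (hn : 0 < n) :
    ptsOfPeriod S n = ⋃ d ∈ n.divisors, {x | minimalPeriod S x = d} := by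
  ext x
  simp [mem_ptsOfPeriod, isPeriodicPt_iff_minimalPeriod_dvd, hn.ne']

open Function in
theorem finite_ptsOfPeriod {X : Type*} (S : X → X)
    (hfin : ∀ n : ℕ, 1 ≤ n → (closedOrbits S n).Finite) {n : ℕ} (hn : 0 < n) :
    (ptsOfPeriod S n).Finite := by
  rw [ptsOfPeriod_eq_biUnion_divisors S hn]
  exact n.divisors.finite_toSet.biUnion fun d hd =>
    (ncard_setOf_minimalPeriod S (Nat.pos_of_mem_divisors hd)
      (hfin d (Nat.pos_of_mem_divisors hd))).1

open Function in
/-- The points fixed by `S^n` are the points whose least period divides `n`. -/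
theorem ncard_ptsOfPeriod {X : Type*} (S : X → X)
    (hfin : ∀ n : ℕ, 1 ≤ n → (closedOrbits S n).Finite) {n : ℕ} (hn : 0 < n) :
    (ptsOfPeriod S n).ncard = ∑ d ∈ n.divisors, d * orbitCount S d := by
  classical
  have hf := finite_ptsOfPeriod S hfin hn
  have hmaps : Set.MapsTo (minimalPeriod S) hf.toFinset n.divisors := by
    intro x hx
    simp only [Set.Finite.coe_toFinset, mem_ptsOfPeriod, isPeriodicPt_iff_minimalPeriod_dvd] at hx
    simp [hx, hn.ne']
  rw [Set.ncard_eq_toFinset_card _ hf, Finset.card_eq_sum_card_fiberwise hmaps]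
  refine Finset.sum_congr rfl fun d hd => ?_
  have hd0 := Nat.pos_of_mem_divisors hd
  have h := ncard_setOf_minimalPeriod S hd0 (hfin d hd0)
  rw [← h.2, Set.ncard_eq_toFinset_card _ h.1]
  congr 1
  ext x
  simp only [Finset.mem_filter, Set.Finite.mem_toFinset, mem_ptsOfPeriod,
    isPeriodicPt_iff_minimalPeriod_dvd]
  exact ⟨fun h => h.2, fun h => ⟨h.symm ▸ Nat.dvd_of_mem_divisors hd, h⟩⟩

theorem cartesianCube_iterate {X : Type*} (T : X → X) (n : ℕ) (x : X × X × X) :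
    (cartesianCube T)^[n] x = (T^[n] x.1, T^[n] x.2.1, T^[n] x.2.2) := by
  induction n generalizing x with
  | zero => rfl
  | succ n ih => simp [Function.iterate_succ_apply, ih, cartesianCube]

open Function in
theorem ptsOfPeriod_cartesianCube {X : Type*} (T : X → X) (n : ℕ) :
    ptsOfPeriod (cartesianCube T) n =
      ptsOfPeriod T n ×ˢ (ptsOfPeriod T n ×ˢ ptsOfPeriod T n) := by
  ext ⟨x, y, z⟩
  simp [mem_ptsOfPeriod, IsPeriodicPt, IsFixedPt, cartesianCube_iterate]

open Function in
/-- A map all of whose iterates have finitely many fixed points has finitely many closed orbits of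
each length. -/
theorem finite_closedOrbits_of_finite_ptsOfPeriod {X : Type*} (S : X → X) {n : ℕ} (hn : 0 < n)
    (h : (ptsOfPeriod S n).Finite) : (closedOrbits S n).Finite := by
  rw [closedOrbits_eq_image S hn]
  refine (h.subset fun x hx => ?_).image _
  exact (mem_ptsOfPeriod).2 (hx ▸ isPeriodicPt_minimalPeriod S x)

theorem finite_closedOrbits_cartesianCube {X : Type*} (T : X → X)
    (hfin : ∀ n : ℕ, 1 ≤ n → (closedOrbits T n).Finite) {n : ℕ} (hn : 1 ≤ n) :
    (closedOrbits (cartesianCube T) n).Finite := by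
  have h := finite_ptsOfPeriod T hfin hn
  refine finite_closedOrbits_of_finite_ptsOfPeriod _ hn ?_
  rw [ptsOfPeriod_cartesianCube]
  exact h.prod (h.prod h)

theorem sum_mul_orbitCount_cartesianCube {X : Type*} (T : X → X)
    (hfin : ∀ n : ℕ, 1 ≤ n → (closedOrbits T n).Finite)
    (hone : ∀ n : ℕ, 1 ≤ n → orbitCount T n = 1) {n : ℕ} (hn : 0 < n) :
    ∑ d ∈ n.divisors, d * orbitCount (cartesianCube T) d = (∑ d ∈ n.divisors, d) ^ 3 := by
  rw [← ncard_ptsOfPeriod _ (fun m hm => finite_closedOrbits_cartesianCube T hfin hm) hn,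
    ptsOfPeriod_cartesianCube, Set.ncard_prod, Set.ncard_prod, ncard_ptsOfPeriod T hfin hn,
    Finset.sum_congr rfl fun d hd => by rw [hone d (Nat.pos_of_mem_divisors hd), mul_one]]
  ring

open Function in
/-- A triple has least period `n` as soon as its first entry has least period `n` and the other two
have period `n`; there are at least `n ^ 3` such triples. -/
theorem sq_le_orbitCount_cartesianCube {X : Type*} (T : X → X)
    (hfin : ∀ n : ℕ, 1 ≤ n → (closedOrbits T n).Finite)
    (hone : ∀ n : ℕ, 1 ≤ n → orbitCount T n = 1) {n : ℕ} (hn : 0 < n) :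
    n ^ 2 ≤ orbitCount (cartesianCube T) n := by
  have h := ncard_setOf_minimalPeriod (cartesianCube T) hn
    (finite_closedOrbits_cartesianCube T hfin hn)
  have hT := ncard_setOf_minimalPeriod T hn (hfin n hn)
  rw [hone n hn, mul_one] at hT
  set A := {x | minimalPeriod T x = n} with hA
  have hsub : A ×ˢ (A ×ˢ A) ⊆ {x | minimalPeriod (cartesianCube T) x = n} := by
    rintro ⟨x, y, z⟩ ⟨hx, hy, hz⟩
    have hx : minimalPeriod T x = n := hx
    have hy : minimalPeriod T y = n := hy
    have hz : minimalPeriod T z = n := hz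
    have h1 : ∀ m, IsPeriodicPt (cartesianCube T) m (x, y, z) ↔
        IsPeriodicPt T m x ∧ IsPeriodicPt T m y ∧ IsPeriodicPt T m z := by
      intro m
      simp [IsPeriodicPt, IsFixedPt, cartesianCube_iterate]
    refine Nat.dvd_antisymm ?_ ?_
    · rw [← isPeriodicPt_iff_minimalPeriod_dvd, h1]
      simp only [isPeriodicPt_iff_minimalPeriod_dvd]
      simp [hx, hy, hz]
    · have := ((h1 _).1 (isPeriodicPt_minimalPeriod (cartesianCube T) (x, y, z))).1
      rwa [isPeriodicPt_iff_minimalPeriod_dvd, hx] at this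
  have h2 := Set.ncard_le_ncard hsub h.1
  rw [Set.ncard_prod, Set.ncard_prod, hT.2, h.2] at h2
  refine Nat.le_of_mul_le_mul_left ?_ hn
  calc n * n ^ 2 = n * (n * n) := by ring
    _ ≤ _ := h2

/-! ### The coefficients and their Euler product -/

theorem orbitDirichletSeries_eq_zeta_iff {X : Type*} (T : X → X) :
    (∀ s : ℂ, 1 < s.re → orbitDirichletSeries T s = riemannZeta s) ↔
      ∀ n : ℕ, 1 ≤ n → orbitCount T n = 1 := by
  constructor
  · intro h n hn
    -- `ζ (2) ≠ 0`, so the value of the series there is not the junk value of a divergent series.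
    have hsum : LSeriesSummable (orbitCoeff T) 2 := by
      by_contra hns
      have h2 := h 2 (by norm_num)
      rw [orbitDirichletSeries, LSeries.eq_zero_of_not_LSeriesSummable _ _ hns] at h2
      exact riemannZeta_ne_zero_of_one_lt_re (by norm_num) h2.symm
    have key := LSeries.eq_of_LSeries_eventually_eq (f := orbitCoeff T) (g := 1) (n := n)
      (hsum.abscissaOfAbsConv_le.trans_lt (EReal.coe_lt_top _))
      ((LSeries.abscissaOfAbsConv_one).trans_lt (EReal.coe_lt_top 1)) ?_ (by omega)
    · simpa [orbitCoeff] using key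
    · filter_upwards [Filter.eventually_gt_atTop 1] with x hx
      have hx' : 1 < (x : ℂ).re := by simpa using hx
      rw [LSeries_one_eq_riemannZeta hx']
      exact h x hx'
  · intro h s hs
    rw [← LSeries_one_eq_riemannZeta hs]
    refine LSeries_congr (fun {n} hn => ?_) s
    simp [orbitCoeff, h n (by omega)]

open ArithmeticFunction ArithmeticFunction.sigma in
theorem sigma_one_le_mul_one_add_log (n : ℕ) :
    (σ 1 n : ℝ) ≤ n * (1 + Real.log n) := by
  rcases Nat.eq_zero_or_pos n with rfl | hn
  · simp
  rw [sigma_eq_sum_div]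
  calc ((∑ d ∈ n.divisors, (n / d) ^ 1 : ℕ) : ℝ) ≤ ∑ d ∈ n.divisors, (n : ℝ) * (d : ℝ)⁻¹ := by
        push_cast
        refine Finset.sum_le_sum fun d hd => ?_
        rw [pow_one, ← div_eq_mul_inv]
        exact Nat.cast_div_le
    _ ≤ ∑ d ∈ Finset.Icc 1 n, (n : ℝ) * (d : ℝ)⁻¹ := by
        refine Finset.sum_le_sum_of_subset_of_nonneg ?_ fun _ _ _ => by positivity
        intro d hd
        exact Finset.mem_Icc.2 ⟨Nat.pos_of_mem_divisors hd, Nat.divisor_le hd⟩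
    _ = n * (harmonic n : ℝ) := by
        rw [← Finset.mul_sum, harmonic_eq_sum_Icc]
        push_cast
        rfl
    _ ≤ n * (1 + Real.log n) := by
        gcongr
        exact harmonic_le_one_add_log n

open ArithmeticFunction ArithmeticFunction.sigma in
/-- If `∑_{d ∣ n} d a(d) = σ(n) ^ 3`, then `n a(n) ≤ σ(n) ^ 3`, so that `a(n) = O(n ^ (2 + ε))`. -/
theorem lseriesSummable_of_sum_mul_eq_sigma_cube {a : ℕ → ℕ}
    (ha : ∀ n : ℕ, 0 < n → ∑ d ∈ n.divisors, d * a d = (σ 1 n) ^ 3) {s : ℂ} (hs : 3 < s.re) :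
    LSeriesSummable (fun n => (a n : ℂ)) s := by
  set δ : ℝ := (s.re - 3) / 6 with hδ
  have hδ0 : 0 < δ := by rw [hδ]; linarith
  refine LSeriesSummable_of_le_const_mul_rpow (x := 3 + 3 * δ) (by rw [hδ]; linarith)
    ⟨(1 + 1 / δ) ^ 3, fun n hn => ?_⟩
  have hn0 : 0 < n := Nat.pos_of_ne_zero hn
  have hn1 : (1 : ℝ) ≤ n := by exact_mod_cast hn0
  have hnpos : (0 : ℝ) < n := by linarith
  have h1 : (n : ℝ) * a n ≤ (σ 1 n : ℝ) ^ 3 := by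
    have := Finset.single_le_sum (f := fun d => d * a d) (fun _ _ => Nat.zero_le _)
      (Nat.mem_divisors_self n hn)
    rw [ha n hn0] at this
    exact_mod_cast this
  have h2 : 1 + Real.log n ≤ (1 + 1 / δ) * (n : ℝ) ^ δ := by
    have h3 := Real.log_le_rpow_div hnpos.le hδ0
    have h4 := Real.one_le_rpow hn1 hδ0.le
    rw [add_mul, one_div, inv_mul_eq_div]
    linarith
  have h3 : (n : ℝ) * a n ≤ n * ((1 + 1 / δ) ^ 3 * (n : ℝ) ^ (3 + 3 * δ - 1)) := by
    calc (n : ℝ) * a n ≤ (σ 1 n : ℝ) ^ 3 := h1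
      _ ≤ (n * ((1 + 1 / δ) * (n : ℝ) ^ δ)) ^ 3 := by
          gcongr
          exact (sigma_one_le_mul_one_add_log n).trans (by gcongr)
      _ = n * ((1 + 1 / δ) ^ 3 * (n : ℝ) ^ (3 + 3 * δ - 1)) := by
          have : (n : ℝ) ^ (3 + 3 * δ - 1) = n ^ 2 * ((n : ℝ) ^ δ) ^ 3 := by
            rw [← Real.rpow_natCast ((n : ℝ) ^ δ), ← Real.rpow_mul hnpos.le,
              ← Real.rpow_natCast (n : ℝ) 2, ← Real.rpow_add hnpos]
            congr 1
            push_cast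
            ring
          rw [this]
          ring
  rw [Complex.norm_natCast]
  exact le_of_mul_le_mul_left h3 hnpos

open ArithmeticFunction ArithmeticFunction.sigma ArithmeticFunction.Moebius in
theorem map_mul_of_sum_mul_eq_sigma_cube {a : ℕ → ℕ}
    (ha : ∀ n : ℕ, 0 < n → ∑ d ∈ n.divisors, d * a d = (σ 1 n) ^ 3) {m n : ℕ}
    (hm : 0 < m) (hn : 0 < n) (hmn : m.Coprime n) : a (m * n) = a m * a n := by
  set F : ArithmeticFunction ℤ := μ * ((σ 1 : ArithmeticFunction ℕ) : ArithmeticFunction ℤ).ppow 3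
    with hF
  have hmult : F.IsMultiplicative :=
    isMultiplicative_moebius.mul (isMultiplicative_sigma.natCast.ppow)
  have hFa : ∀ n : ℕ, 0 < n → F n = (n : ℤ) * a n := by
    refine fun n hn => ?_
    have := (sum_eq_iff_sum_mul_moebius_eq (R := ℤ) (f := fun n => (n : ℤ) * a n)
      (g := fun n => (σ 1 n : ℤ) ^ 3)).1 (fun n hn => by exact_mod_cast ha n hn) n hn
    rw [← this, hF, mul_apply]
    simp
  have h := hmult.map_mul_of_coprime hmn
  rw [hFa _ hm, hFa _ hn, hFa _ (Nat.mul_pos hm hn)] at h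
  have h2 : (m * n) * a (m * n) = (m * n) * (a m * a n) := by
    zify
    push_cast at h
    rw [h]
    ring
  exact Nat.eq_of_mul_eq_mul_left (Nat.mul_pos hm hn) h2

open ArithmeticFunction ArithmeticFunction.sigma in
/-- The value at a prime power: telescoping gives `p ^ k a(p ^ k) = σ(p ^ k) ^ 3 - σ(p ^ (k-1)) ^ 3`,
which expands into three geometric progressions. The formula also holds for `k = 0`. -/
theorem prime_pow_of_sum_mul_eq_sigma_cube {a : ℕ → ℕ}
    (ha : ∀ n : ℕ, 0 < n → ∑ d ∈ n.divisors, d * a d = (σ 1 n) ^ 3) {p : ℕ} (hp : p.Prime)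
    (k : ℕ) : (a (p ^ k) : ℂ) * ((p : ℂ) - 1) ^ 2 =
      ((p : ℂ) ^ 2 + p + 1) * ((p : ℂ) ^ 2) ^ k - 3 * ((p : ℂ) + 1) * (p : ℂ) ^ k + 3 := by
  have hp1 : ((p : ℂ) - 1) ≠ 0 := by
    rw [sub_ne_zero]
    exact_mod_cast hp.one_lt.ne'
  have hp0 : (p : ℂ) ≠ 0 := by exact_mod_cast hp.ne_zero
  have hσ : ∀ k, (σ 1 (p ^ k) : ℂ) * ((p : ℂ) - 1) = (p : ℂ) ^ (k + 1) - 1 := by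
    intro k
    rw [sigma_one_apply_prime_pow hp]
    push_cast
    exact geom_sum_mul (p : ℂ) (k + 1)
  have hsum : ∀ k, ∑ i ∈ Finset.range (k + 1), (p : ℂ) ^ i * a (p ^ i) = (σ 1 (p ^ k) : ℂ) ^ 3 := by
    intro k
    have := ha (p ^ k) (pow_pos hp.pos k)
    rw [Nat.sum_divisors_prime_pow hp] at this
    exact_mod_cast this
  apply mul_right_cancel₀ (b := (p : ℂ) ^ k * ((p : ℂ) - 1))
    (mul_ne_zero (pow_ne_zero _ hp0) hp1)
  cases k with
  | zero =>
    have := hsum 0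
    simp at this
    simp only [pow_zero, this, Nat.cast_one]
    ring
  | succ k =>
    have h1 := hsum (k + 1)
    rw [Finset.sum_range_succ, hsum k] at h1
    have e1 := congrArg (· ^ 3) (hσ (k + 1))
    have e2 := congrArg (· ^ 3) (hσ k)
    have h2 : (p : ℂ) ^ (k + 1) * a (p ^ (k + 1)) * ((p : ℂ) - 1) ^ 3 =
        ((p : ℂ) ^ (k + 1 + 1) - 1) ^ 3 - ((p : ℂ) ^ (k + 1) - 1) ^ 3 := by
      rw [← e1, ← e2, mul_pow, mul_pow, ← h1]
      ring
    calc _ = (p : ℂ) ^ (k + 1) * a (p ^ (k + 1)) * ((p : ℂ) - 1) ^ 3 := by ring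
      _ = _ := by rw [h2]; ring

theorem norm_natCast_cpow_lt_one {p : ℕ} (hp : 1 < p) {w : ℂ} (hw : w.re < 0) :
    ‖(p : ℂ) ^ w‖ < 1 := by
  rw [Complex.norm_natCast_cpow_of_pos (by omega)]
  exact Real.rpow_lt_one_of_one_lt_of_neg (by exact_mod_cast hp) hw

open ArithmeticFunction ArithmeticFunction.sigma in
theorem tsum_term_prime_pow_of_sum_mul_eq_sigma_cube {a : ℕ → ℕ}
    (ha : ∀ n : ℕ, 0 < n → ∑ d ∈ n.divisors, d * a d = (σ 1 n) ^ 3) {s : ℂ} (hs : 3 < s.re)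
    (p : Nat.Primes) :
    ∑' k : ℕ, LSeries.term (fun n => (a n : ℂ)) s ((p : ℕ) ^ k) =
      (1 - ((p : ℕ) : ℂ) ^ (-s))⁻¹ * (1 - ((p : ℕ) : ℂ) ^ (-(s - 1)))⁻¹ *
        (1 - ((p : ℕ) : ℂ) ^ (-(s - 2)))⁻¹ * cubeEulerFactor s p := by
  obtain ⟨p, hp⟩ := p
  simp only [cubeEulerFactor]
  have hp1 : ((p : ℂ) - 1) ≠ 0 := by
    rw [sub_ne_zero]
    exact_mod_cast hp.one_lt.ne'
  have hp0 : (p : ℂ) ≠ 0 := by exact_mod_cast hp.ne_zero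
  set u : ℂ := (p : ℂ) ^ (-s) with hu
  have e1 : (p : ℂ) ^ (-(s - 1)) = p * u := by
    rw [hu, show -(s - 1) = 1 + -s by ring, Complex.cpow_add _ _ hp0, Complex.cpow_one]
  have e2 : (p : ℂ) ^ (-(s - 2)) = p ^ 2 * u := by
    rw [hu, show -(s - 2) = (2 : ℕ) + -s by push_cast; ring, Complex.cpow_add _ _ hp0,
      Complex.cpow_natCast]
  have e3 : (p : ℂ) ^ (1 - 2 * s) = p * u ^ 2 := by
    rw [hu, show 1 - 2 * s = 1 + (-s + -s) by ring, Complex.cpow_add _ _ hp0, Complex.cpow_one,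
      Complex.cpow_add _ _ hp0, sq]
  have n0 : ‖u‖ < 1 := norm_natCast_cpow_lt_one hp.one_lt (by simp; linarith)
  have n1 : ‖(p : ℂ) * u‖ < 1 := e1 ▸ norm_natCast_cpow_lt_one hp.one_lt (by simp; linarith)
  have n2 : ‖(p : ℂ) ^ 2 * u‖ < 1 := e2 ▸ norm_natCast_cpow_lt_one hp.one_lt (by simp; linarith)
  rw [e1, e2, e3]
  have hterm : ∀ k, LSeries.term (fun n => (a n : ℂ)) s (p ^ k) =
      ((p : ℂ) ^ 2 + p + 1) / ((p : ℂ) - 1) ^ 2 * ((p : ℂ) ^ 2 * u) ^ k -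
        3 * ((p : ℂ) + 1) / ((p : ℂ) - 1) ^ 2 * ((p : ℂ) * u) ^ k +
        3 / ((p : ℂ) - 1) ^ 2 * u ^ k := by
    intro k
    have huk : ((p ^ k : ℕ) : ℂ) ^ (-s) = u ^ k := by
      rw [hu, ← Complex.cpow_nat_mul, mul_comm, Nat.cast_pow, ← Complex.natCast_cpow_natCast_mul,
        mul_comm]
    rw [LSeries.term_of_ne_zero (pow_pos hp.pos k).ne', div_eq_mul_inv, ← Complex.cpow_neg, huk]
    have h := prime_pow_of_sum_mul_eq_sigma_cube ha hp k
    rw [← eq_div_iff (pow_ne_zero 2 hp1)] at h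
    rw [h, mul_pow, mul_pow]
    ring
  have hs2 := (hasSum_geometric_of_norm_lt_one n2).mul_left
    (((p : ℂ) ^ 2 + p + 1) / ((p : ℂ) - 1) ^ 2)
  have hs1 := (hasSum_geometric_of_norm_lt_one n1).mul_left
    (3 * ((p : ℂ) + 1) / ((p : ℂ) - 1) ^ 2)
  have hs0 := (hasSum_geometric_of_norm_lt_one n0).mul_left (3 / ((p : ℂ) - 1) ^ 2)
  have hne : ∀ z : ℂ, ‖z‖ < 1 → 1 - z ≠ 0 := by
    intro z hz h
    rw [sub_eq_zero] at h
    rw [← h, norm_one] at hz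
    exact lt_irrefl _ hz
  have d0 := hne _ n0
  have d1 := hne _ n1
  have d2 := hne _ n2
  simp_rw [hterm]
  rw [((hs2.sub hs1).add hs0).tsum_eq]
  field_simp
  ring

open ArithmeticFunction ArithmeticFunction.sigma in
theorem hasProd_eulerFactor_of_sum_mul_eq_sigma_cube {a : ℕ → ℕ}
    (ha : ∀ n : ℕ, 0 < n → ∑ d ∈ n.divisors, d * a d = (σ 1 n) ^ 3) {s : ℂ} (hs : 3 < s.re) :
    HasProd (fun p : Nat.Primes => (1 - ((p : ℕ) : ℂ) ^ (-s))⁻¹ *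
      (1 - ((p : ℕ) : ℂ) ^ (-(s - 1)))⁻¹ * (1 - ((p : ℕ) : ℂ) ^ (-(s - 2)))⁻¹ *
        cubeEulerFactor s p) (LSeries (fun n => (a n : ℂ)) s) := by
  have h := EulerProduct.eulerProduct_hasProd (f := LSeries.term (fun n => (a n : ℂ)) s) ?_ ?_
    (lseriesSummable_of_sum_mul_eq_sigma_cube ha hs).norm (LSeries.term_zero _ _)
  · simp_rw [tsum_term_prime_pow_of_sum_mul_eq_sigma_cube ha hs] at h
    exact h
  · have h1 : a 1 = 1 := by simpa using ha 1 one_pos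
    simp [LSeries.term_of_ne_zero, h1]
  · intro m n hmn
    rcases Nat.eq_zero_or_pos m with rfl | hm
    · simp
    rcases Nat.eq_zero_or_pos n with rfl | hn
    · simp
    rw [LSeries.term_of_ne_zero (Nat.mul_pos hm hn).ne', LSeries.term_of_ne_zero hm.ne',
      LSeries.term_of_ne_zero hn.ne', map_mul_of_sum_mul_eq_sigma_cube ha hm hn hmn,
      Nat.cast_mul, Nat.cast_mul, Complex.natCast_mul_natCast_cpow]
    rw [mul_div_mul_comm]

/-! ### The abscissa of convergence and the product formula -/

open Filter Topology in
/-- If the coefficients satisfy `a(n) ≥ n ^ 2`, the Dirichlet series diverges for `Re s < 3`, even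
conditionally. On a short block `MN < n ≤ (M + 1)N` with `M ≥ |Im s|` the arguments of the terms
`a(n) n ^ {-s}` differ by at most one radian, so their sum is bounded below, and the partial
sums are not Cauchy. -/
theorem three_le_re_of_dirichletConvergesAt {a : ℕ → ℕ} (ha : ∀ n : ℕ, 0 < n → n ^ 2 ≤ a n) {s : ℂ}
    (hs : DirichletConvergesAt (fun n => (a n : ℂ)) s) : 3 ≤ s.re := by
  by_contra! hlt
  obtain ⟨l, hl⟩ := hs
  obtain ⟨M, hM⟩ := exists_nat_ge (|s.im| + 1)
  have hM1 : (1 : ℝ) ≤ M := by linarith [abs_nonneg s.im]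
  have hMt : |s.im| ≤ M := by linarith
  have hM0 : 0 < M := by exact_mod_cast lt_of_lt_of_le one_pos hM1
  have t1 : Tendsto (fun N : ℕ => M * N) atTop atTop := tendsto_id.const_mul_atTop' hM0
  have t2 : Tendsto (fun N : ℕ => (M + 1) * N) atTop atTop :=
    tendsto_id.const_mul_atTop' (Nat.succ_pos M)
  have hdiff := ((hl.comp t2).sub (hl.comp t1)).norm
  rw [sub_self, norm_zero] at hdiff
  have hpos : (0 : ℝ) < 1 / (2 * (M + 1)) := by positivity
  obtain ⟨N, hN1, hN⟩ := ((hdiff.eventually_lt_const hpos).and (eventually_gt_atTop 0)).exists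
  simp only [Function.comp_apply] at hN1
  have hNpos : (0 : ℝ) < N := by exact_mod_cast hN
  have hsub : ∑ n ∈ Finset.Icc 1 ((M + 1) * N), (a n : ℂ) / (n : ℂ) ^ s -
      ∑ n ∈ Finset.Icc 1 (M * N), (a n : ℂ) / (n : ℂ) ^ s =
      ∑ n ∈ Finset.Ioc (M * N) ((M + 1) * N), (a n : ℂ) / (n : ℂ) ^ s := by
    rw [sub_eq_iff_eq_add', ← Finset.sum_union]
    · congr 1
      ext n
      simp only [Finset.mem_Icc, Finset.mem_union, Finset.mem_Ioc]
      have hle : M * N ≤ (M + 1) * N := Nat.mul_le_mul_right N (Nat.le_succ M)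
      omega
    · rw [Finset.disjoint_left]
      intro n h1 h2
      simp only [Finset.mem_Icc, Finset.mem_Ioc] at h1 h2
      omega
  rw [hsub] at hN1
  set c : ℂ := Complex.exp ((s.im * Real.log (M * N) : ℝ) * Complex.I) with hc
  have hcn : ‖c‖ = 1 := Complex.norm_exp_ofReal_mul_I _
  have hterm : ∀ n ∈ Finset.Ioc (M * N) ((M + 1) * N),
      1 / (2 * (M + 1)) / (N : ℝ) ≤ ((a n : ℂ) / (n : ℂ) ^ s * c).re := by
    intro n hn
    rw [Finset.mem_Ioc] at hn
    have hMN : (0 : ℝ) < M * N := by positivity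
    have h1 : (M * N : ℝ) < n := by exact_mod_cast hn.1
    have h2 : (n : ℝ) ≤ (M + 1) * N := by exact_mod_cast hn.2
    have hn0 : (0 : ℝ) < n := hMN.trans h1
    have hnN : 0 < n := by exact_mod_cast hn0
    have e1 : (a n : ℂ) / (n : ℂ) ^ s * c =
        ((a n : ℝ) : ℂ) * Complex.exp (-s * Real.log n + (s.im * Real.log (M * N) : ℝ) * Complex.I) := by
      rw [Complex.exp_add, ← hc, div_eq_mul_inv, ← Complex.cpow_neg,
        Complex.cpow_def_of_ne_zero (by exact_mod_cast hnN.ne'), ← Complex.natCast_log]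
      push_cast
      ring_nf
    rw [e1, Complex.re_ofReal_mul, Complex.exp_re]
    have e2 : (-s * Real.log n + (s.im * Real.log (M * N) : ℝ) * Complex.I).re =
        -(s.re * Real.log n) := by
      generalize Real.log n = L
      simp
    have e3 : (-s * Real.log n + (s.im * Real.log (M * N) : ℝ) * Complex.I).im =
        -(s.im * (Real.log n - Real.log (M * N))) := by
      generalize Real.log n = L
      simp
      ring
    rw [e2, e3, Real.cos_neg]
    have hlog0 : 0 ≤ Real.log n - Real.log (M * N) :=
      sub_nonneg.2 (Real.log_le_log hMN h1.le)
    have hlog1 : Real.log n - Real.log (M * N) ≤ 1 / M := by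
      rw [← Real.log_div hn0.ne' hMN.ne']
      refine (Real.log_le_sub_one_of_pos (by positivity)).trans ?_
      rw [sub_le_iff_le_add, div_le_iff₀ hMN]
      refine h2.trans (le_of_eq ?_)
      have : (M : ℝ) ≠ 0 := by positivity
      field_simp
      ring
    have habs : |s.im * (Real.log n - Real.log (M * N))| ≤ 1 := by
      rw [abs_mul, abs_of_nonneg hlog0]
      calc |s.im| * (Real.log n - Real.log (M * N)) ≤ M * (1 / M) := by gcongr
        _ = 1 := by field_simp
    have hcos : 1 / 2 ≤ Real.cos (s.im * (Real.log n - Real.log (M * N))) := by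
      have h3 := Real.one_sub_sq_div_two_le_cos (x := s.im * (Real.log n - Real.log (M * N)))
      have h4 := (sq_le_one_iff_abs_le_one _).2 habs
      linarith
    have hexp : ((n : ℝ) ^ 3)⁻¹ ≤ Real.exp (-(s.re * Real.log n)) := by
      rw [Real.exp_neg]
      apply inv_anti₀ (Real.exp_pos _)
      rw [← Real.exp_log hn0, ← Real.exp_nat_mul, Real.log_exp]
      apply Real.exp_le_exp.2
      have : 0 ≤ Real.log n := Real.log_natCast_nonneg n
      push_cast
      nlinarith
    have han : (n : ℝ) ^ 2 ≤ a n := by exact_mod_cast ha n hnN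
    calc 1 / (2 * (M + 1)) / (N : ℝ) = 1 / ((M + 1) * N) * (1 / 2) := by field_simp
      _ ≤ 1 / n * (1 / 2) := by gcongr
      _ = n ^ 2 * (((n : ℝ) ^ 3)⁻¹ * (1 / 2)) := by field_simp
      _ ≤ _ := by gcongr
  have hsum := Finset.card_nsmul_le_sum _ _ _ hterm
  rw [Nat.card_Ioc, ← Nat.sub_mul, Nat.add_sub_cancel_left, one_mul, nsmul_eq_mul,
    mul_div_cancel₀ _ hNpos.ne', ← Complex.re_sum, ← Finset.sum_mul] at hsum
  have := hsum.trans (Complex.re_le_norm _)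
  rw [norm_mul, hcn, mul_one] at this
  linarith

open Filter Topology in
theorem LSeriesSummable.dirichletConvergesAt {f : ℕ → ℂ} {s : ℂ} (h : LSeriesSummable f s) :
    DirichletConvergesAt f s := by
  refine ⟨LSeries f s, ?_⟩
  have h1 := (h.LSeriesHasSum.tendsto_sum_nat).comp (tendsto_add_atTop_nat 1)
  refine h1.congr fun N => ?_
  simp only [Function.comp_apply]
  rw [Finset.range_eq_Ico, Finset.sum_eq_sum_Ico_succ_bot (Nat.succ_pos N), LSeries.term_zero,
    zero_add]
  refine Finset.sum_congr ?_ fun n hn => ?_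
  · ext n
    simp only [Finset.mem_Icc, Finset.mem_Ico]
    omega
  · rw [Finset.mem_Icc] at hn
    rw [LSeries.term_of_ne_zero (by omega)]

theorem abscissaOfConvergence_eq_three {a : ℕ → ℕ} (ha : ∀ n : ℕ, 0 < n → n ^ 2 ≤ a n)
    (hsum : ∀ s : ℂ, 3 < s.re → LSeriesSummable (fun n => (a n : ℂ)) s) :
    abscissaOfConvergence (fun n => (a n : ℂ)) = 3 := by
  have e3 : (3 : EReal) = ((3 : ℝ) : EReal) := rfl
  rw [e3]
  apply le_antisymm
  · refine le_of_forall_gt_imp_ge_of_dense fun c hc => ?_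
    obtain ⟨x, hx3, hxc⟩ := EReal.lt_iff_exists_real_btwn.1 hc
    have hx3 : 3 < x := by exact_mod_cast hx3
    refine le_trans (sInf_le ⟨(x : ℂ), ?_, rfl⟩) (by simpa using hxc.le)
    exact (hsum _ (by simpa using hx3)).dirichletConvergesAt
  · refine le_sInf ?_
    rintro _ ⟨s, hs, rfl⟩
    have := three_le_re_of_dirichletConvergesAt ha hs
    exact EReal.coe_le_coe_iff.2 this

theorem norm_cubeEulerFactor_sub_one_le {s : ℂ} (p : Nat.Primes) :
    ‖cubeEulerFactor s p - 1‖ ≤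
      4 * ((p : ℕ) : ℝ) ^ (1 - s.re) + ((p : ℕ) : ℝ) ^ (1 - 2 * s.re) := by
  obtain ⟨p, hp⟩ := p
  have hp0 : (0 : ℝ) < p := by exact_mod_cast hp.pos
  have hp1 : (1 : ℝ) ≤ p := by exact_mod_cast hp.one_le
  simp only [cubeEulerFactor]
  rw [add_assoc, add_sub_cancel_left]
  refine (norm_add_le _ _).trans ?_
  rw [norm_mul, Complex.norm_natCast_cpow_of_pos hp.pos, Complex.norm_natCast_cpow_of_pos hp.pos]
  have h1 : ‖(2 * (p : ℂ) + 2)‖ ≤ 4 * p := by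
    have : (2 * (p : ℂ) + 2) = ((2 * p + 2 : ℕ) : ℂ) := by push_cast; rfl
    rw [this, Complex.norm_natCast]
    push_cast
    linarith
  have h2 : (p : ℝ) ^ (1 - s.re) = p * (p : ℝ) ^ (-s.re) := by
    rw [sub_eq_add_neg, Real.rpow_add hp0, Real.rpow_one]
  have h3 : (1 - 2 * s).re = 1 - 2 * s.re := by simp
  have h4 : (-s).re = -s.re := by simp
  rw [h2, h3, h4, ← mul_assoc]
  gcongr

theorem multipliable_cubeEulerFactor {s : ℂ} (hs : 2 < s.re) :
    Multipliable (cubeEulerFactor s) := by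
  have h : Summable fun p : Nat.Primes => ‖cubeEulerFactor s p - 1‖ := by
    refine Summable.of_nonneg_of_le (fun _ => norm_nonneg _)
      (fun p => norm_cubeEulerFactor_sub_one_le p) ?_
    exact ((Nat.Primes.summable_rpow.2 (by linarith)).mul_left 4).add
      (Nat.Primes.summable_rpow.2 (by linarith))
  simpa using multipliable_one_add_of_summable h

open ArithmeticFunction ArithmeticFunction.sigma in
theorem lseries_eq_zeta_mul_tprod_cubeEulerFactor {a : ℕ → ℕ}
    (ha : ∀ n : ℕ, 0 < n → ∑ d ∈ n.divisors, d * a d = (σ 1 n) ^ 3) {s : ℂ} (hs : 3 < s.re) :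
    LSeries (fun n => (a n : ℂ)) s = riemannZeta s * riemannZeta (s - 1) * riemannZeta (s - 2) *
      ∏' p : Nat.Primes, cubeEulerFactor s p := by
  have h0 := riemannZeta_eulerProduct_hasProd (s := s) (by linarith)
  have h1 := riemannZeta_eulerProduct_hasProd (s := s - 1) (by simp; linarith)
  have h2 := riemannZeta_eulerProduct_hasProd (s := s - 2) (by simp; linarith)
  have h3 := (multipliable_cubeEulerFactor (s := s) (by linarith)).hasProd
  exact (hasProd_eulerFactor_of_sum_mul_eq_sigma_cube ha hs).unique (((h0.mul h1).mul h2).mul h3)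

/-! ### The number of zeros of the zeta function -/

/-- The entire function `s (s - 1) Λ(s)`, written through Mathlib's `Λ₀`; up to the factor `1/2`
it is Riemann's `ξ`. -/
noncomputable def riemannXi (s : ℂ) : ℂ := s * (s - 1) * completedRiemannZeta₀ s + 1

theorem differentiable_riemannXi : Differentiable ℂ riemannXi := by
  unfold riemannXi
  have := differentiable_completedZeta₀
  fun_prop

theorem riemannXi_eq {s : ℂ} (h0 : s ≠ 0) (h1 : s ≠ 1) :
    riemannXi s = s * (s - 1) * completedRiemannZeta s := by
  rw [riemannXi, completedRiemannZeta_eq]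
  have h2 : s - 1 ≠ 0 := sub_ne_zero.2 h1
  have h3 : 1 - s ≠ 0 := sub_ne_zero.2 h1.symm
  field_simp
  ring

theorem riemannXi_one_sub (s : ℂ) : riemannXi (1 - s) = riemannXi s := by
  rw [riemannXi, riemannXi, completedRiemannZeta₀_one_sub]
  ring

theorem completedRiemannZeta_eq_Gammaℝ_mul {s : ℂ} (hs : 0 < s.re) :
    completedRiemannZeta s = Complex.Gammaℝ s * riemannZeta s := by
  have h0 : s ≠ 0 := by
    rintro rfl
    simp at hs
  rw [riemannZeta_def_of_ne_zero h0, mul_div_cancel₀ _ (Complex.Gammaℝ_ne_zero_of_re_pos hs)]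

theorem riemannXi_eq_zero_of_riemannZeta_eq_zero {s : ℂ} (hs : 0 < s.re)
    (hz : riemannZeta s = 0) : riemannXi s = 0 := by
  have h0 : s ≠ 0 := by
    rintro rfl
    simp at hs
  have h1 : s ≠ 1 := by
    rintro rfl
    exact riemannZeta_one_ne_zero hz
  rw [riemannXi_eq h0 h1, completedRiemannZeta_eq_Gammaℝ_mul hs, hz]
  simp

theorem riemannXi_two_ne_zero : riemannXi 2 ≠ 0 := by
  have h2 : (0 : ℝ) < (2 : ℂ).re := by simp
  rw [riemannXi_eq (by norm_num) (by norm_num), completedRiemannZeta_eq_Gammaℝ_mul h2]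
  refine mul_ne_zero (by norm_num) (mul_ne_zero (Complex.Gammaℝ_ne_zero_of_re_pos h2) ?_)
  exact riemannZeta_ne_zero_of_one_lt_re (by norm_num)

open MeasureTheory in
theorem norm_Gamma_le_Gamma_re {s : ℂ} (hs : 0 < s.re) :
    ‖Complex.Gamma s‖ ≤ Real.Gamma s.re := by
  rw [Complex.Gamma_eq_integral hs, Complex.GammaIntegral, Real.Gamma_eq_integral hs]
  refine (norm_integral_le_integral_norm _).trans (le_of_eq ?_)
  refine setIntegral_congr_fun measurableSet_Ioi fun x hx => ?_
  rw [norm_mul, Complex.norm_real, Real.norm_of_nonneg (Real.exp_pos _).le,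
    Complex.norm_cpow_eq_rpow_re_of_pos hx]
  simp

theorem Gamma_le_exp_sq {x : ℝ} (hx : 1 ≤ x) : Real.Gamma x ≤ Real.exp ((x + 2) ^ 2) := by
  set n := ⌈x⌉₊ with hn
  have h1 : x ≤ n := Nat.le_ceil x
  have h2 : (n : ℝ) < x + 1 := Nat.ceil_lt_add_one (by linarith)
  have h3 : Real.Gamma x ≤ Real.Gamma (x + 1) := by
    rw [Real.Gamma_add_one (by linarith)]
    exact le_mul_of_one_le_left (Real.Gamma_pos_of_pos (by linarith)).le hx
  have h4 : Real.Gamma (x + 1) ≤ Real.Gamma (n + 1) :=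
    Real.Gamma_strictMonoOn_Ici.monotoneOn (Set.mem_Ici.2 (by linarith))
      (Set.mem_Ici.2 (by linarith)) (by linarith)
  have h5 : (n.factorial : ℝ) ≤ (n : ℝ) ^ n := by exact_mod_cast Nat.factorial_le_pow n
  have h6 : (n : ℝ) ≤ Real.exp n := by linarith [Real.add_one_le_exp (n : ℝ)]
  calc Real.Gamma x ≤ n.factorial := by rw [← Real.Gamma_nat_eq_factorial]; exact h3.trans h4
    _ ≤ (n : ℝ) ^ n := h5
    _ ≤ Real.exp n ^ n := by gcongr
    _ = Real.exp (n * n) := (Real.exp_nat_mul _ _).symm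
    _ ≤ Real.exp ((x + 2) ^ 2) := by
        apply Real.exp_le_exp.2
        nlinarith

open MeasureTheory in
/-- `Λ₀` is bounded on a vertical strip because it is a Mellin transform that converges absolutely
everywhere. -/
theorem exists_norm_completedRiemannZeta₀_le_of_mem_strip (a b : ℝ) :
    ∃ C : ℝ, ∀ s : ℂ, a ≤ s.re → s.re ≤ b → ‖completedRiemannZeta₀ s‖ ≤ C := by
  set P := HurwitzZeta.hurwitzEvenFEPair 0 with hP
  have hconv : ∀ s : ℂ, MellinConvergent P.f_modif s := fun s =>
    ((P.isStrongFEPair_toStrongFEPair).hasMellin s).1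
  have hint : ∀ x : ℝ, IntegrableOn (fun t : ℝ => t ^ (x - 1) * ‖P.f_modif t‖) (Set.Ioi 0) := by
    intro x
    have h := (hconv (x : ℂ)).norm
    refine (integrableOn_congr_fun (fun t ht => ?_) measurableSet_Ioi).1 h
    rw [norm_smul, Complex.norm_cpow_eq_rpow_re_of_pos ht]
    simp
  refine ⟨(∫ t in Set.Ioi (0 : ℝ), (t ^ (a / 2 - 1) * ‖P.f_modif t‖ +
    t ^ (b / 2 - 1) * ‖P.f_modif t‖)) / 2, fun s ha hb => ?_⟩
  have hdef : completedRiemannZeta₀ s = mellin P.f_modif (s / 2) / 2 := rfl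
  rw [hdef, norm_div, Complex.norm_ofNat, mellin]
  gcongr
  refine (norm_integral_le_integral_norm _).trans ?_
  refine setIntegral_mono_on (hconv (s / 2)).norm ((hint _).add (hint _)) measurableSet_Ioi ?_
  intro t ht
  have ht : 0 < t := ht
  rw [norm_smul, Complex.norm_cpow_eq_rpow_re_of_pos ht, ← add_mul]
  gcongr
  have hre : (s / 2 - 1 : ℂ).re = s.re / 2 - 1 := by simp
  rw [hre]
  rcases le_total t 1 with h1 | h1
  · have h2 : t ^ (s.re / 2 - 1) ≤ t ^ (a / 2 - 1) :=
      Real.rpow_le_rpow_of_exponent_ge ht h1 (by linarith)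
    refine h2.trans ?_
    exact le_add_of_nonneg_right (Real.rpow_nonneg ht.le _)
  · have h2 : t ^ (s.re / 2 - 1) ≤ t ^ (b / 2 - 1) :=
      Real.rpow_le_rpow_of_exponent_le h1 (by linarith)
    refine h2.trans ?_
    exact le_add_of_nonneg_left (Real.rpow_nonneg ht.le _)

theorem exists_norm_riemannZeta_le :
    ∃ C : ℝ, ∀ s : ℂ, 2 ≤ s.re → ‖riemannZeta s‖ ≤ C := by
  have hsum : Summable fun n : ℕ => 1 / (n : ℝ) ^ 2 := Real.summable_one_div_nat_pow.2 one_lt_two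
  refine ⟨∑' n : ℕ, 1 / (n : ℝ) ^ 2, fun s hs => ?_⟩
  rw [zeta_eq_tsum_one_div_nat_cpow (by linarith)]
  refine tsum_of_norm_bounded hsum.hasSum fun n => ?_
  rcases Nat.eq_zero_or_pos n with rfl | hn
  · simp [Complex.zero_cpow (show s ≠ 0 by rintro rfl; norm_num at hs)]
  rw [norm_div, norm_one, Complex.norm_natCast_cpow_of_pos hn, ← Real.rpow_natCast]
  have : (1 : ℝ) ≤ n := by exact_mod_cast hn
  gcongr
  · exact_mod_cast hs

/-- The function `ξ` has finite order. -/
theorem exists_norm_riemannXi_le :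
    ∃ A : ℝ, 0 < A ∧ ∀ s : ℂ, ‖riemannXi s‖ ≤ A * Real.exp (2 * (‖s‖ + 3) ^ 2) := by
  obtain ⟨C1, hC1⟩ := exists_norm_completedRiemannZeta₀_le_of_mem_strip (1 / 2) 2
  obtain ⟨C2, hC2⟩ := exists_norm_riemannZeta_le
  have hC20 : 0 ≤ C2 := (norm_nonneg _).trans (hC2 2 (by simp))
  have hC10 : 0 ≤ C1 := (norm_nonneg _).trans (hC1 1 (by norm_num) (by norm_num))
  have hsq : ∀ x : ℝ, 0 ≤ x → (x * (x + 1)) ≤ Real.exp ((x + 2) ^ 2) := by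
    intro x hx
    nlinarith [Real.add_one_le_exp ((x + 2) ^ 2)]
  have hnorm : ∀ s : ℂ, ‖s * (s - 1)‖ ≤ ‖s‖ * (‖s‖ + 1) := by
    intro s
    rw [norm_mul]
    gcongr
    simpa using norm_sub_le s 1
  -- By the functional equation only `Re s ≥ 1/2` has to be considered.
  have key : ∀ s : ℂ, 1 / 2 ≤ s.re →
      ‖riemannXi s‖ ≤ (C1 + C2 + 1) * Real.exp (2 * (‖s‖ + 2) ^ 2) := by
    intro s hs
    set E := Real.exp ((‖s‖ + 2) ^ 2) with hE
    have hE1 : 1 ≤ E := Real.one_le_exp (by positivity)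
    have hEE : Real.exp (2 * (‖s‖ + 2) ^ 2) = E * E := by
      rw [hE, ← Real.exp_add]
      ring_nf
    have h1 := (hnorm s).trans (hsq _ (norm_nonneg s))
    rw [hEE]
    rcases le_total s.re 2 with h | h
    · have h2 := hC1 s hs h
      calc ‖riemannXi s‖ ≤ ‖s * (s - 1)‖ * ‖completedRiemannZeta₀ s‖ + 1 := by
            rw [riemannXi]
            refine (norm_add_le _ _).trans ?_
            rw [norm_mul (s * (s - 1)), norm_one]
        _ ≤ E * C1 + 1 := by gcongr
        _ ≤ (C1 + C2 + 1) * (E * E) := by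
            nlinarith [mul_nonneg hC10 (sub_nonneg.2 hE1), mul_nonneg hC20 (sub_nonneg.2 hE1),
              mul_nonneg (mul_nonneg hC10 (sub_nonneg.2 hE1)) (zero_le_one.trans hE1),
              mul_nonneg hC20 (mul_nonneg (zero_le_one.trans hE1) (zero_le_one.trans hE1)),
              mul_nonneg (sub_nonneg.2 hE1) (zero_le_one.trans hE1)]
    · have hs0 : s ≠ 0 := by rintro rfl; norm_num at h
      have hs1 : s ≠ 1 := by rintro rfl; norm_num at h
      rw [riemannXi_eq hs0 hs1, completedRiemannZeta_eq_Gammaℝ_mul (by linarith)]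
      have hG : ‖Complex.Gammaℝ s‖ ≤ E := by
        rw [Complex.Gammaℝ_def, norm_mul, Complex.norm_cpow_eq_rpow_re_of_pos Real.pi_pos]
        have hre : (s / 2).re = s.re / 2 := by simp
        have hre' : (-s / 2).re = -(s.re / 2) := by simp [neg_div]
        have h3 : ‖Complex.Gamma (s / 2)‖ ≤ E := by
          refine (norm_Gamma_le_Gamma_re (by rw [hre]; linarith)).trans ?_
          rw [hre]
          refine (Gamma_le_exp_sq (by linarith)).trans ?_
          apply Real.exp_le_exp.2
          have := Complex.re_le_norm s
          gcongr
          linarith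
        have h4 : Real.pi ^ ((-s / 2).re) ≤ 1 := by
          rw [hre']
          exact Real.rpow_le_one_of_one_le_of_nonpos (by linarith [Real.pi_gt_three])
            (by linarith)
        calc _ ≤ 1 * E := by gcongr
          _ = E := one_mul E
      rw [norm_mul, norm_mul (Complex.Gammaℝ s)]
      calc ‖s * (s - 1)‖ * (‖Complex.Gammaℝ s‖ * ‖riemannZeta s‖) ≤ E * (E * C2) := by
            gcongr
            exact hC2 s h
        _ ≤ (C1 + C2 + 1) * (E * E) := by
            have h6 : 0 ≤ E * E := mul_self_nonneg E
            nlinarith [mul_nonneg hC10 h6]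
  refine ⟨C1 + C2 + 1, by positivity, fun s => ?_⟩
  rcases le_total (1 / 2) s.re with h | h
  · refine (key s h).trans ?_
    gcongr
    norm_num
  · rw [← riemannXi_one_sub]
    refine (key (1 - s) (by simp; linarith)).trans ?_
    have h1 := norm_sub_le 1 s
    rw [norm_one] at h1
    have h2 : ‖1 - s‖ + 2 ≤ ‖s‖ + 3 := by linarith
    gcongr

open MeromorphicOn Metric in
/-- A nonzero analytic function has at least as many zeros with multiplicity as distinct zeros, so
Jensen's inequality bounds the latter. -/
theorem card_zeros_le_of_norm_le {f : ℂ → ℂ} {c : ℂ} {r R M : ℝ} (hr : 0 < r) (hrR : r < R)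
    (hM : 1 ≤ M) (hf : Differentiable ℂ f) (hc : f c ≠ 0) (hb : ∀ z ∈ sphere c R, ‖f z‖ ≤ M)
    (S : Finset ℂ) (hS : ∀ z ∈ S, z ∈ closedBall c r ∧ f z = 0) :
    (S.card : ℝ) ≤ Real.log (M / ‖f c‖) / Real.log (R / r) := by
  have hR : 0 < R := hr.trans hrR
  have han : AnalyticOnNhd ℂ f Set.univ := fun z _ => hf.analyticAt z
  have hJ := AnalyticOnNhd.sum_divisor_le (c := c) (r := r) (R := R) (M := M) (f := f)
    (by rwa [abs_of_pos hr]) (by rwa [abs_of_pos hr, abs_of_pos hR]) hM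
    (han.mono (Set.subset_univ _)) hc (by rwa [abs_of_pos hR])
  rw [abs_of_pos hr] at hJ
  refine le_trans ?_ hJ
  set D := divisor f (closedBall c r) with hD
  have hanb : AnalyticOnNhd ℂ f (closedBall c r) := han.mono (Set.subset_univ _)
  have hnn : ∀ u, 0 ≤ D u := fun u => (AnalyticOnNhd.divisor_nonneg hanb) u
  have hone : ∀ u ∈ S, 1 ≤ D u := by
    intro u hu
    rw [hD, hanb.divisor_apply (hS u hu).1]
    have h1 : analyticOrderAt f u ≠ 0 := by
      rw [Ne, (hf.analyticAt u).analyticOrderAt_eq_zero]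
      exact fun h => h (hS u hu).2
    have h2 : analyticOrderAt f u ≠ ⊤ := by
      rw [Ne, analyticOrderAt_eq_top]
      intro h
      have := han.eqOn_zero_of_preconnected_of_eventuallyEq_zero isPreconnected_univ
        (Set.mem_univ u) h
      exact hc (this (Set.mem_univ c))
    obtain ⟨n, hn⟩ := ENat.ne_top_iff_exists.1 h2
    rw [← hn] at h1 ⊢
    have h3 : n ≠ 0 := by simpa using h1
    have : (1 : ℤ) ≤ n := by exact_mod_cast Nat.pos_of_ne_zero h3
    simpa using this
  have hfin : (Function.support D).Finite := D.finiteSupport (isCompact_closedBall c r)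
  rw [finsum_eq_sum_of_support_subset _ (s := hfin.toFinset) (by simp)]
  have hsub : S ⊆ hfin.toFinset := by
    intro u hu
    rw [Set.Finite.mem_toFinset, Function.mem_support]
    have := hone u hu
    omega
  have : (S.card : ℤ) ≤ ∑ u ∈ hfin.toFinset, D u := by
    calc (S.card : ℤ) = ∑ u ∈ S, 1 := by simp
      _ ≤ ∑ u ∈ S, D u := Finset.sum_le_sum hone
      _ ≤ _ := Finset.sum_le_sum_of_subset_of_nonneg hsub fun u _ _ => hnn u
  exact_mod_cast this

/-- The zeros of `ζ` with positive real part and imaginary part at most `t` in absolute value. -/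
def zetaZerosUpTo (t : ℝ) : Set ℂ := {ρ | riemannZeta ρ = 0 ∧ 0 < ρ.re ∧ |ρ.im| ≤ t}

open Metric in
theorem zetaZerosUpTo_subset_closedBall {t : ℝ} :
    zetaZerosUpTo t ⊆ closedBall 2 (t + 3) := by
  rintro ρ ⟨h0, h1, h2⟩
  have h3 : ρ.re < 1 := by
    by_contra! h
    exact riemannZeta_ne_zero_of_one_le_re h h0
  rw [mem_closedBall, dist_eq_norm]
  refine (Complex.norm_le_abs_re_add_abs_im _).trans ?_
  have h4 : |(ρ - 2).re| ≤ 3 := by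
    rw [abs_le]
    constructor <;> simp <;> linarith
  have h5 : |(ρ - 2).im| ≤ t := by simpa using h2
  linarith

theorem finite_zetaZerosUpTo (t : ℝ) : (zetaZerosUpTo t).Finite := by
  refine (IsCompact.inter_riemannZetaZeros_finite
    (isCompact_closedBall (2 : ℂ) (t + 3))).subset fun ρ hρ => ?_
  exact ⟨zetaZerosUpTo_subset_closedBall hρ, hρ.1⟩

open Metric in
/-- A polynomial bound for the number of zeros of `ζ` up to a given height: Jensen's inequality for
`ξ` in the disc with centre `2`. -/
theorem exists_ncard_zetaZerosUpTo_le :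
    ∃ A : ℝ, 0 ≤ A ∧ ∀ t : ℝ, 0 ≤ t → ((zetaZerosUpTo t).ncard : ℝ) ≤ A * (t + 1) ^ 2 := by
  obtain ⟨B, hB0, hB⟩ := exists_norm_riemannXi_le
  set L := |Real.log ((B + 1) / ‖riemannXi 2‖)| with hL
  refine ⟨(L + 400) / Real.log 3, by positivity, fun t ht => ?_⟩
  have hlog3 : 0 < Real.log 3 := Real.log_pos (by norm_num)
  have hx2 : 0 < ‖riemannXi 2‖ := norm_pos_iff.2 riemannXi_two_ne_zero
  set Q := 2 * (3 * (t + 3) + 5) ^ 2 with hQ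
  have h := card_zeros_le_of_norm_le (f := riemannXi) (c := 2) (r := t + 3) (R := 3 * (t + 3))
    (M := (B + 1) * Real.exp Q) (by linarith) (by linarith)
    ?_ differentiable_riemannXi riemannXi_two_ne_zero ?_
    (finite_zetaZerosUpTo t).toFinset ?_
  · rw [mul_div_cancel_right₀ _ (by linarith : t + 3 ≠ 0)] at h
    rw [Set.ncard_eq_toFinset_card _ (finite_zetaZerosUpTo t)]
    refine h.trans ?_
    rw [div_mul_eq_mul_div]
    gcongr
    rw [mul_div_right_comm, Real.log_mul (by positivity) (Real.exp_pos _).ne', Real.log_exp]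
    have h1 : Real.log ((B + 1) / ‖riemannXi 2‖) ≤ L := le_abs_self _
    have h2 : 0 ≤ L := abs_nonneg _
    nlinarith [mul_nonneg h2 ht, mul_nonneg h2 (mul_nonneg ht ht)]
  · have : 1 ≤ Real.exp Q := Real.one_le_exp (by positivity)
    nlinarith
  · intro z hz
    rw [mem_sphere, dist_eq_norm] at hz
    have hz' : ‖z‖ ≤ 3 * (t + 3) + 2 := by
      calc ‖z‖ = ‖(z - 2) + 2‖ := by ring_nf
        _ ≤ ‖z - 2‖ + ‖(2 : ℂ)‖ := norm_add_le _ _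
        _ = _ := by rw [hz]; simp
    refine (hB z).trans ?_
    have hz3 : ‖z‖ + 3 ≤ 3 * (t + 3) + 5 := by linarith
    rw [hQ]
    gcongr
    linarith
  · intro z hz
    rw [Set.Finite.mem_toFinset] at hz
    exact ⟨zetaZerosUpTo_subset_closedBall hz,
      riemannXi_eq_zero_of_riemannZeta_eq_zero hz.2.1 hz.1⟩

/-! ### Clearing the Euler factors -/

open Polynomial in
/-- Polynomials obtained from `1 + 2X` by clearing the coefficients of `X, X², X³, …` one after the
other: the coefficient `c` of `X ^ (n + 1)` is removed by the factor `(1 - X ^ (n + 1)) ^ c` if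
`c ≥ 0` and by `(1 + X ^ (n + 1)) ^ (-c)` if `c ≤ 0`. -/
noncomputable def clearedPoly : ℕ → ℤ[X]
  | 0 => 1 + 2 * X
  | n + 1 => clearedPoly n * ((1 - X ^ (n + 1)) ^ ((clearedPoly n).coeff (n + 1)).toNat *
      (1 + X ^ (n + 1)) ^ (-(clearedPoly n).coeff (n + 1)).toNat)

theorem dvd_one_add_mul_pow_sub {R : Type*} [CommRing R] {D Y t : R} (h : D ∣ Y * Y) (a : ℕ) :
    D ∣ (1 + t * Y) ^ a - (1 + a * t * Y) := by
  induction a with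
  | zero => simp
  | succ a ih =>
    obtain ⟨u, hu⟩ := ih
    obtain ⟨v, hv⟩ := h
    refine ⟨u * (1 + t * Y) + a * t * t * v, ?_⟩
    push_cast
    linear_combination (1 + t * Y) * hu + a * t * t * hv

open Polynomial in
theorem X_pow_dvd_clearedPoly_sub_one (n : ℕ) : X ^ (n + 1) ∣ clearedPoly n - 1 := by
  induction n with
  | zero => exact ⟨2, by simp [clearedPoly]; ring⟩
  | succ n ih =>
    set c := (clearedPoly n).coeff (n + 1) with hc
    set Y : ℤ[X] := X ^ (n + 1) with hY
    set D : ℤ[X] := X ^ (n + 1 + 1) with hD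
    have hDY : D ∣ Y * Y := by
      rw [hD, hY, ← pow_add]
      exact pow_dvd_pow X (by omega)
    have h1 : D ∣ clearedPoly n - (1 + (c : ℤ[X]) * Y) := by
      rw [hD, X_pow_dvd_iff]
      intro d hd
      rcases Nat.lt_succ_iff_lt_or_eq.1 hd with h | h
      · have h2 := X_pow_dvd_iff.1 ih d h
        have h3 : ((c : ℤ[X]) * Y).coeff d = 0 := by
          rw [hY, coeff_mul_X_pow', if_neg (by omega)]
        rw [← sub_sub, coeff_sub, h2, h3, sub_zero]
      · have h3 : ((c : ℤ[X]) * Y).coeff d = c := by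
          rw [hY, h, coeff_mul_X_pow', if_pos le_rfl, Nat.sub_self]
          simp
        rw [← sub_sub, coeff_sub, h3, h, coeff_sub, coeff_one, if_neg (by omega), hc]
        ring
    have h2 := dvd_one_add_mul_pow_sub (t := -1) hDY c.toNat
    have h3 := dvd_one_add_mul_pow_sub (t := 1) hDY (-c).toNat
    have e1 : (1 : ℤ[X]) - Y = 1 + -1 * Y := by ring
    have e2 : (1 : ℤ[X]) + Y = 1 + 1 * Y := by ring
    have hcc : (c : ℤ[X]) = (c.toNat : ℤ[X]) - ((-c).toNat : ℤ[X]) := by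
      conv_lhs => rw [← Int.toNat_sub_toNat_neg c]
      push_cast
      rfl
    rw [clearedPoly, ← hc, e1, e2]
    obtain ⟨u, hu⟩ := h1
    obtain ⟨v, hv⟩ := h2
    obtain ⟨w, hw⟩ := h3
    obtain ⟨y, hy⟩ := hDY
    rw [sub_eq_iff_eq_add] at hu hv hw
    rw [hu, hv, hw, hcc]
    generalize (c.toNat : ℤ[X]) = a
    generalize ((-c).toNat : ℤ[X]) = b
    refine (Dvd.intro (u * ((1 - a * Y) * (1 + b * Y)) +
      (1 + (a - b) * Y + D * u) * (v * (1 + b * Y) + (1 - a * Y) * w + D * v * w) +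
      y * (-a * b - (a - b) * (a - b) - (a - b) * a * b * Y)) ?_)
    linear_combination (-(-a * b - (a - b) * (a - b) - (a - b) * a * b * Y)) * hy

open Polynomial in
/-- The factor by which `clearedPoly (n + 1)` differs from `clearedPoly n`, as a function. -/
noncomputable def clearingFactor (n : ℕ) (z : ℂ) : ℂ :=
  (1 - z ^ (n + 1)) ^ ((clearedPoly n).coeff (n + 1)).toNat *
    (1 + z ^ (n + 1)) ^ (-(clearedPoly n).coeff (n + 1)).toNat

open Polynomial in
theorem aeval_clearedPoly (K : ℕ) (z : ℂ) :
    aeval z (clearedPoly K) = (1 + 2 * z) * ∏ n ∈ Finset.range K, clearingFactor n z := by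
  induction K with
  | zero =>
    have h2 : aeval z (2 : ℤ[X]) = 2 := map_ofNat _ 2
    simp [clearedPoly, h2]
  | succ K ih =>
    rw [clearedPoly, map_mul, ih, Finset.prod_range_succ, ← mul_assoc]
    congr 1
    simp [clearingFactor]

@[fun_prop]
theorem differentiable_clearingFactor (n : ℕ) : Differentiable ℂ (clearingFactor n) := by
  unfold clearingFactor
  fun_prop

theorem exists_norm_prod_clearingFactor_le (K : ℕ) :
    ∃ C : ℝ, 0 ≤ C ∧ ∀ z : ℂ, ‖z‖ ≤ 1 → ‖∏ n ∈ Finset.range K, clearingFactor n z‖ ≤ C := by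
  have hc : Continuous fun z => ∏ n ∈ Finset.range K, clearingFactor n z :=
    continuous_finsetProd _ fun n _ => (differentiable_clearingFactor n).continuous
  obtain ⟨C, hC⟩ := (isCompact_closedBall (0 : ℂ) 1).exists_bound_of_continuousOn hc.continuousOn
  exact ⟨C, (norm_nonneg _).trans (hC 0 (by simp)), fun z hz => hC z (by simpa using hz)⟩

open Polynomial in
theorem exists_norm_aeval_clearedPoly_sub_one_le (K : ℕ) :
    ∃ C : ℝ, 0 ≤ C ∧ ∀ z : ℂ, ‖z‖ ≤ 1 → ‖aeval z (clearedPoly K) - 1‖ ≤ C * ‖z‖ ^ (K + 1) := by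
  obtain ⟨R, hR⟩ := X_pow_dvd_clearedPoly_sub_one K
  have hc : Continuous fun z : ℂ => aeval z R := R.continuous_aeval
  obtain ⟨C, hC⟩ := (isCompact_closedBall (0 : ℂ) 1).exists_bound_of_continuousOn hc.continuousOn
  refine ⟨C, (norm_nonneg _).trans (hC 0 (by simp)), fun z hz => ?_⟩
  have h := congrArg (aeval z) hR
  rw [map_sub, map_one, map_mul, map_pow, aeval_X] at h
  rw [h, norm_mul, norm_pow, mul_comm]
  gcongr
  exact hC z (by simpa using hz)

theorem cubeEulerFactor_eq (s : ℂ) (p : Nat.Primes) :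
    cubeEulerFactor s p = 1 + 2 * ((p : ℕ) : ℂ) ^ (1 - s) +
      (2 * ((p : ℕ) : ℂ) ^ (1 - s) + (((p : ℕ) : ℂ) ^ (1 - s)) ^ 2) / ((p : ℕ) : ℂ) := by
  have hp0 : ((p : ℕ) : ℂ) ≠ 0 := by exact_mod_cast p.2.ne_zero
  have e1 : ((p : ℕ) : ℂ) ^ (1 - s) = (p : ℕ) * ((p : ℕ) : ℂ) ^ (-s) := by
    rw [sub_eq_add_neg, Complex.cpow_add _ _ hp0, Complex.cpow_one]
  have e2 : ((p : ℕ) : ℂ) ^ (1 - 2 * s) = (p : ℕ) * (((p : ℕ) : ℂ) ^ (-s)) ^ 2 := by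
    rw [show 1 - 2 * s = 1 + (-s + -s) by ring, Complex.cpow_add _ _ hp0, Complex.cpow_one,
      Complex.cpow_add _ _ hp0, sq]
  rw [cubeEulerFactor, e1, e2]
  field_simp
  ring

/-- The Euler factor at `p` multiplied by the first `K` clearing factors in `p ^ (1 - s)`. -/
noncomputable def clearedEulerFactor (K : ℕ) (s : ℂ) (p : Nat.Primes) : ℂ :=
  cubeEulerFactor s p * ∏ n ∈ Finset.range K, clearingFactor n (((p : ℕ) : ℂ) ^ (1 - s))

theorem norm_prime_cpow_one_sub (s : ℂ) (p : Nat.Primes) :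
    ‖((p : ℕ) : ℂ) ^ (1 - s)‖ = ((p : ℕ) : ℝ) ^ (-(s.re - 1)) := by
  rw [Complex.norm_natCast_cpow_of_pos p.2.pos]
  congr 1
  simp

/-- After clearing, the Euler factor at `p` is `1 + O(p ^ (-(K + 1)(σ - 1)) + p ^ (-σ))`. -/
theorem exists_norm_clearedEulerFactor_sub_one_le (K : ℕ) :
    ∃ C : ℝ, ∀ x : ℝ, 1 ≤ x → ∀ s : ℂ, x ≤ s.re → ∀ p : Nat.Primes,
      ‖clearedEulerFactor K s p - 1‖ ≤
        C * (((p : ℕ) : ℝ) ^ (-((K + 1) * (x - 1))) + ((p : ℕ) : ℝ) ^ (-x)) := by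
  obtain ⟨C1, hC1, h1⟩ := exists_norm_prod_clearingFactor_le K
  obtain ⟨C2, hC2, h2⟩ := exists_norm_aeval_clearedPoly_sub_one_le K
  refine ⟨C2 + 3 * C1, fun x hx s hs p => ?_⟩
  have hp1 : (1 : ℝ) ≤ (p : ℕ) := by exact_mod_cast p.2.one_le
  have hp0 : (0 : ℝ) < (p : ℕ) := by linarith
  have hzx : ‖((p : ℕ) : ℂ) ^ (1 - s)‖ ≤ ((p : ℕ) : ℝ) ^ (-(x - 1)) := by
    rw [norm_prime_cpow_one_sub]
    exact Real.rpow_le_rpow_of_exponent_le hp1 (by linarith)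
  have hz1 : ‖((p : ℕ) : ℂ) ^ (1 - s)‖ ≤ 1 :=
    hzx.trans (Real.rpow_le_one_of_one_le_of_nonpos hp1 (by linarith))
  rw [clearedEulerFactor, cubeEulerFactor_eq]
  set z := ((p : ℕ) : ℂ) ^ (1 - s) with hz
  set Q := ∏ n ∈ Finset.range K, clearingFactor n z with hQ
  have e : (1 + 2 * z + (2 * z + z ^ 2) / ((p : ℕ) : ℂ)) * Q - 1 =
      ((1 + 2 * z) * Q - 1) + (2 + z) * z / ((p : ℕ) : ℂ) * Q := by ring
  have h3 : ‖(2 + z) * z / ((p : ℕ) : ℂ) * Q‖ ≤ 3 * C1 * ((p : ℕ) : ℝ) ^ (-x) := by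
    have h4 : ‖2 + z‖ ≤ 3 := by
      refine (norm_add_le _ _).trans ?_
      rw [Complex.norm_ofNat]
      linarith
    have h5 : ((p : ℕ) : ℝ) ^ (-(x - 1)) / (p : ℕ) = ((p : ℕ) : ℝ) ^ (-x) := by
      rw [show -(x - 1) = -x + 1 by ring, Real.rpow_add hp0, Real.rpow_one,
        mul_div_cancel_right₀ _ hp0.ne']
    rw [norm_mul, norm_div, norm_mul, Complex.norm_natCast]
    calc ‖2 + z‖ * ‖z‖ / (p : ℕ) * ‖Q‖ ≤ 3 * ((p : ℕ) : ℝ) ^ (-(x - 1)) / (p : ℕ) * C1 := by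
          gcongr
          exact h1 z hz1
      _ = 3 * C1 * ((p : ℕ) : ℝ) ^ (-x) := by rw [mul_div_assoc, h5]; ring
  have h6 : ‖(1 + 2 * z) * Q - 1‖ ≤ C2 * ((p : ℕ) : ℝ) ^ (-((K + 1) * (x - 1))) := by
    rw [← aeval_clearedPoly]
    refine (h2 z hz1).trans ?_
    have h7 : ((p : ℕ) : ℝ) ^ (-((K + 1) * (x - 1))) = (((p : ℕ) : ℝ) ^ (-(x - 1))) ^ (K + 1) := by
      rw [← Real.rpow_natCast, ← Real.rpow_mul hp0.le]
      congr 1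
      push_cast
      ring
    rw [h7]
    gcongr
  rw [e]
  refine (norm_add_le _ _).trans ((add_le_add h6 h3).trans ?_)
  have h8 : 0 ≤ ((p : ℕ) : ℝ) ^ (-((K + 1) * (x - 1))) := Real.rpow_nonneg hp0.le _
  have h9 : 0 ≤ ((p : ℕ) : ℝ) ^ (-x) := Real.rpow_nonneg hp0.le _
  nlinarith [mul_nonneg hC1 h8, mul_nonneg hC2 h9]

theorem summable_clearedEulerFactor_bound {K : ℕ} {x : ℝ} (hx : 1 < (K + 1) * (x - 1)) (C : ℝ) :
    Summable fun p : Nat.Primes =>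
      C * (((p : ℕ) : ℝ) ^ (-((K + 1) * (x - 1))) + ((p : ℕ) : ℝ) ^ (-x)) := by
  have hx1 : 1 < x := by
    by_contra! h
    have : ((K : ℝ) + 1) * (x - 1) ≤ 0 :=
      mul_nonpos_of_nonneg_of_nonpos (by positivity) (by linarith)
    linarith
  exact ((Nat.Primes.summable_rpow.2 (by linarith)).add
    (Nat.Primes.summable_rpow.2 (by linarith))).mul_left C

/-- The open half-plane `Re s > 1 + 1 / (K + 1)`. -/
def clearedHalfPlane (K : ℕ) : Set ℂ := {s : ℂ | 1 < ((K : ℝ) + 1) * (s.re - 1)}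

theorem isOpen_clearedHalfPlane (K : ℕ) : IsOpen (clearedHalfPlane K) := by
  have : Continuous fun s : ℂ => ((K : ℝ) + 1) * (s.re - 1) := by fun_prop
  exact isOpen_lt continuous_const this

theorem one_lt_re_of_mem_clearedHalfPlane {K : ℕ} {s : ℂ} (hs : s ∈ clearedHalfPlane K) :
    1 < s.re := by
  by_contra! h
  have h1 : ((K : ℝ) + 1) * (s.re - 1) ≤ 0 :=
    mul_nonpos_of_nonneg_of_nonpos (by positivity) (by linarith)
  have h2 : 1 < ((K : ℝ) + 1) * (s.re - 1) := hs
  linarith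

theorem clearedHalfPlane_mono {K L : ℕ} (h : K ≤ L) : clearedHalfPlane K ⊆ clearedHalfPlane L := by
  intro s hs
  have h1 := one_lt_re_of_mem_clearedHalfPlane hs
  have h2 : 1 < ((K : ℝ) + 1) * (s.re - 1) := hs
  have h3 : (K : ℝ) ≤ L := by exact_mod_cast h
  change 1 < ((L : ℝ) + 1) * (s.re - 1)
  nlinarith

theorem multipliable_clearedEulerFactor {K : ℕ} {s : ℂ} (hs : s ∈ clearedHalfPlane K) :
    Multipliable (clearedEulerFactor K s) := by
  obtain ⟨C, hC⟩ := exists_norm_clearedEulerFactor_sub_one_le K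
  have h : Summable fun p : Nat.Primes => ‖clearedEulerFactor K s p - 1‖ :=
    Summable.of_nonneg_of_le (fun _ => norm_nonneg _)
      (fun p => hC s.re (one_lt_re_of_mem_clearedHalfPlane hs).le s le_rfl p)
      (summable_clearedEulerFactor_bound hs C)
  simpa using multipliable_one_add_of_summable h

theorem differentiable_clearedEulerFactor (K : ℕ) (p : Nat.Primes) :
    Differentiable ℂ fun s => clearedEulerFactor K s p := by
  have hp0 : ((p : ℕ) : ℂ) ≠ 0 := by exact_mod_cast p.2.ne_zero
  have hz : Differentiable ℂ fun s : ℂ => ((p : ℕ) : ℂ) ^ (1 - s) := by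
    intro s
    exact DifferentiableAt.const_cpow (by fun_prop) (Or.inl hp0)
  have hprod : Differentiable ℂ fun s : ℂ =>
      ∏ n ∈ Finset.range K, clearingFactor n (((p : ℕ) : ℂ) ^ (1 - s)) :=
    Differentiable.fun_finsetProd fun n _ => (differentiable_clearingFactor n).comp hz
  unfold clearedEulerFactor
  simp_rw [cubeEulerFactor_eq]
  exact Differentiable.mul (by fun_prop) hprod

theorem analyticAt_tprod_clearedEulerFactor {K : ℕ} {s : ℂ} (hs : s ∈ clearedHalfPlane K) :
    AnalyticAt ℂ (fun s => ∏' p, clearedEulerFactor K s p) s := by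
  obtain ⟨C, hC⟩ := exists_norm_clearedEulerFactor_sub_one_le K
  have hs1 := one_lt_re_of_mem_clearedHalfPlane hs
  have hK : (0 : ℝ) < (K : ℝ) + 1 := by positivity
  have hs2 : 1 / ((K : ℝ) + 1) < s.re - 1 := by
    rw [div_lt_iff₀' hK]
    exact hs
  obtain ⟨x, hx1, hx2⟩ := exists_between hs2
  have hx0 : 0 < x := lt_trans (by positivity) hx1
  have hx3 : 1 < ((K : ℝ) + 1) * ((x + 1) - 1) := by
    rw [add_sub_cancel_right]
    rwa [div_lt_iff₀' hK] at hx1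
  set V : Set ℂ := {s : ℂ | x + 1 < s.re} with hV
  have hVo : IsOpen V := isOpen_lt continuous_const Complex.continuous_re
  have hsV : s ∈ V := by
    change x + 1 < s.re
    linarith
  have hu := summable_clearedEulerFactor_bound hx3 C
  have hlu := hu.hasProdLocallyUniformlyOn_one_add
    (f := fun p s => clearedEulerFactor K s p - 1) hVo
    (Filter.Eventually.of_forall fun p t ht => hC (x + 1) (by linarith) t (le_of_lt ht) p)
    (fun p => ((differentiable_clearedEulerFactor K p).continuous.sub
      continuous_const).continuousOn)
  simp only [add_sub_cancel] at hlu
  have hd := (hasProdLocallyUniformlyOn_iff_tendstoLocallyUniformlyOn.1 hlu).differentiableOn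
    (Filter.Eventually.of_forall fun S => ?_) hVo
  · exact hd.analyticAt (hVo.mem_nhds hsV)
  · exact (Differentiable.fun_finsetProd fun p _ =>
      differentiable_clearedEulerFactor K p).differentiableOn

/-! ### Meromorphic continuation -/

theorem meromorphicAt_riemannZeta (z : ℂ) : MeromorphicAt riemannZeta z := by
  rcases ne_or_eq z 1 with h | rfl
  · exact (analyticOn_riemannZeta z h).meromorphicAt
  -- The first power of `s - 1` vanishes at `s = 1`, where the limit of `(s - 1) ζ(s)` is `1`.
  refine ⟨2, Complex.analyticAt_of_differentiable_on_punctured_nhds_of_continuousAt ?_ ?_⟩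
  · filter_upwards [self_mem_nhdsWithin] with s hs
    have := differentiableAt_riemannZeta hs
    simp only [smul_eq_mul]
    fun_prop
  · rw [← continuousWithinAt_compl_self, ContinuousWithinAt]
    have h1 : Filter.Tendsto (fun s : ℂ => s - 1) (nhdsWithin 1 {1}ᶜ) (nhds (1 - 1)) :=
      ((continuous_id.sub continuous_const).tendsto 1).mono_left nhdsWithin_le_nhds
    have h2 := h1.mul riemannZeta_residue_one
    simp only [sub_self, zero_mul] at h2
    simp only [sub_self, smul_eq_mul, ne_eq, OfNat.ofNat_ne_zero, not_false_eq_true, zero_pow,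
      zero_mul]
    refine h2.congr fun s => ?_
    ring

/-- The meromorphic continuation of `∏_p (1 / clearingFactor n (p ^ (-w)))`. -/
noncomputable def zetaFactor (n : ℕ) (w : ℂ) : ℂ :=
  riemannZeta ((n + 1 : ℕ) * w) ^ ((clearedPoly n).coeff (n + 1)).toNat *
    (riemannZeta ((2 * (n + 1) : ℕ) * w) / riemannZeta ((n + 1 : ℕ) * w)) ^
      (-(clearedPoly n).coeff (n + 1)).toNat

theorem hasProd_clearingFactor {n : ℕ} {w : ℂ} (hw : 1 < ((n : ℝ) + 1) * w.re) :
    zetaFactor n w ≠ 0 ∧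
      HasProd (fun p : Nat.Primes => clearingFactor n (((p : ℕ) : ℂ) ^ (-w))) (zetaFactor n w)⁻¹ := by
  have hre1 : 1 < (((n + 1 : ℕ) : ℂ) * w).re := by
    have : (((n + 1 : ℕ) : ℂ) * w).re = ((n : ℝ) + 1) * w.re := by
      rw [← Complex.ofReal_natCast, Complex.re_ofReal_mul]
      push_cast
      ring
    rwa [this]
  have hre2 : 1 < (((2 * (n + 1) : ℕ) : ℂ) * w).re := by
    have : (((2 * (n + 1) : ℕ) : ℂ) * w).re = 2 * (((n : ℝ) + 1) * w.re) := by
      rw [← Complex.ofReal_natCast, Complex.re_ofReal_mul]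
      push_cast
      ring
    rw [this]
    linarith
  have hz1 := riemannZeta_ne_zero_of_one_lt_re hre1
  have hz2 := riemannZeta_ne_zero_of_one_lt_re hre2
  refine ⟨mul_ne_zero (pow_ne_zero _ hz1) (pow_ne_zero _ (div_ne_zero hz2 hz1)), ?_⟩
  have h1 := (riemannZeta_eulerProduct_hasProd hre1).inv₀ hz1
  have h2 := (riemannZeta_eulerProduct_hasProd hre2).inv₀ hz2
  simp only [inv_inv] at h1 h2
  have hpow : ∀ (p : Nat.Primes) (k : ℕ),
      ((p : ℕ) : ℂ) ^ (-((k : ℂ) * w)) = (((p : ℕ) : ℂ) ^ (-w)) ^ k := by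
    intro p k
    rw [← Complex.cpow_nat_mul]
    congr 1
    ring
  simp only [hpow] at h1 h2
  have h3 := h2.div₀ h1 (inv_ne_zero hz1)
  have h4 := (h1.pow ((clearedPoly n).coeff (n + 1)).toNat).mul
    (h3.pow (-(clearedPoly n).coeff (n + 1)).toNat)
  have hval : (zetaFactor n w)⁻¹ = (riemannZeta ((n + 1 : ℕ) * w))⁻¹ ^
      ((clearedPoly n).coeff (n + 1)).toNat *
      ((riemannZeta ((2 * (n + 1) : ℕ) * w))⁻¹ / (riemannZeta ((n + 1 : ℕ) * w))⁻¹) ^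
      (-(clearedPoly n).coeff (n + 1)).toNat := by
    rw [zetaFactor, mul_inv, inv_pow, ← inv_pow _ (-(clearedPoly n).coeff (n + 1)).toNat, inv_div,
      inv_div_inv]
  rw [hval]
  refine h4.congr_fun fun p => ?_
  set z := ((p : ℕ) : ℂ) ^ (-w) with hz
  have hz1 : ‖z ^ (n + 1)‖ < 1 := by
    rw [← hpow]
    exact norm_natCast_cpow_lt_one p.2.one_lt (by rw [Complex.neg_re]; linarith)
  have hne : 1 - z ^ (n + 1) ≠ 0 := by
    intro h
    rw [sub_eq_zero] at h
    rw [← h, norm_one] at hz1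
    exact lt_irrefl _ hz1
  rw [clearingFactor]
  congr 2
  rw [eq_div_iff hne]
  ring

/-- The continuation of the Dirichlet series to `clearedHalfPlane K`: the clearing factors turn the
Euler product into a convergent one, and are compensated by values of `ζ`. -/
noncomputable def cubeContinuation (K : ℕ) (s : ℂ) : ℂ :=
  riemannZeta s * riemannZeta (s - 1) * riemannZeta (s - 2) *
    (∏ n ∈ Finset.range K, zetaFactor n (s - 1)) * ∏' p, clearedEulerFactor K s p

theorem cubeContinuation_succ {K : ℕ} {s : ℂ} (hs : s ∈ clearedHalfPlane K) :
    cubeContinuation (K + 1) s = cubeContinuation K s := by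
  have hs' : 1 < ((K : ℝ) + 1) * (s - 1).re := by simpa [clearedHalfPlane] using hs
  obtain ⟨hne, hprod⟩ := hasProd_clearingFactor hs'
  simp only [neg_sub] at hprod
  have h := ((multipliable_clearedEulerFactor hs).hasProd.mul hprod).tprod_eq
  have e : ∀ p, clearedEulerFactor (K + 1) s p =
      clearedEulerFactor K s p * clearingFactor K (((p : ℕ) : ℂ) ^ (1 - s)) := by
    intro p
    rw [clearedEulerFactor, clearedEulerFactor, Finset.prod_range_succ, mul_assoc]
  simp_rw [cubeContinuation, e]
  rw [h, Finset.prod_range_succ]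
  field_simp

theorem cubeContinuation_eq_of_le {K L : ℕ} (h : K ≤ L) {s : ℂ} (hs : s ∈ clearedHalfPlane K) :
    cubeContinuation L s = cubeContinuation K s := by
  induction L, h using Nat.le_induction with
  | base => rfl
  | succ L hL ih => rw [cubeContinuation_succ (clearedHalfPlane_mono hL hs), ih]

theorem analyticAt_zeta_natCast_mul_sub_one {k : ℕ} {s : ℂ} (h : (k : ℂ) * (s - 1) ≠ 1) :
    AnalyticAt ℂ (fun s => riemannZeta ((k : ℂ) * (s - 1))) s :=
  AnalyticAt.fun_comp (f := fun s : ℂ => (k : ℂ) * (s - 1)) (analyticOn_riemannZeta _ h)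
    (by fun_prop)

theorem meromorphicAt_zeta_natCast_mul_sub_one (k : ℕ) (s : ℂ) :
    MeromorphicAt (fun s => riemannZeta ((k : ℂ) * (s - 1))) s :=
  MeromorphicAt.comp_analyticAt (g := fun s : ℂ => (k : ℂ) * (s - 1))
    (meromorphicAt_riemannZeta _) (by fun_prop)

theorem meromorphicAt_cubeContinuation {K : ℕ} {s : ℂ} (hs : s ∈ clearedHalfPlane K) :
    MeromorphicAt (cubeContinuation K) s := by
  have h0 := meromorphicAt_riemannZeta s
  have h1 : MeromorphicAt (fun s => riemannZeta (s - 1)) s :=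
    MeromorphicAt.comp_analyticAt (g := fun s : ℂ => s - 1) (meromorphicAt_riemannZeta _)
      (by fun_prop)
  have h2 : MeromorphicAt (fun s => riemannZeta (s - 2)) s :=
    MeromorphicAt.comp_analyticAt (g := fun s : ℂ => s - 2) (meromorphicAt_riemannZeta _)
      (by fun_prop)
  have h3 : MeromorphicAt (fun s => ∏ n ∈ Finset.range K, zetaFactor n (s - 1)) s := by
    refine MeromorphicAt.fun_prod fun n _ => ?_
    exact ((meromorphicAt_zeta_natCast_mul_sub_one (n + 1) s).pow _).mul
      (((meromorphicAt_zeta_natCast_mul_sub_one (2 * (n + 1)) s).div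
        (meromorphicAt_zeta_natCast_mul_sub_one (n + 1) s)).pow _)
  exact (((h0.mul h1).mul h2).mul h3).mul (analyticAt_tprod_clearedEulerFactor hs).meromorphicAt

theorem analyticAt_cubeContinuation {K : ℕ} {s : ℂ} (hs : s ∈ clearedHalfPlane K)
    (him : s.im ≠ 0) (hz : ∀ j : ℕ, 0 < j → riemannZeta ((j : ℂ) * (s - 1)) ≠ 0) :
    AnalyticAt ℂ (cubeContinuation K) s := by
  have hne : ∀ j : ℕ, (j : ℂ) * (s - 1) ≠ 1 := by
    intro j h
    have h1 := congrArg Complex.im h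
    rw [← Complex.ofReal_natCast, Complex.im_ofReal_mul] at h1
    simp only [Complex.sub_im, Complex.one_im, sub_zero, mul_eq_zero, him, or_false] at h1
    rw [Nat.cast_eq_zero] at h1
    simp [h1] at h
  have h0 : AnalyticAt ℂ riemannZeta s :=
    analyticOn_riemannZeta s (by rintro rfl; simp at him)
  have h1 : AnalyticAt ℂ (fun s => riemannZeta (s - 1)) s := by
    simpa using analyticAt_zeta_natCast_mul_sub_one (hne 1)
  have h2 : AnalyticAt ℂ (fun s => riemannZeta (s - 2)) s := by
    refine AnalyticAt.fun_comp (f := fun s : ℂ => s - 2) (analyticOn_riemannZeta _ ?_) (by fun_prop)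
    intro h
    have h3 := congrArg Complex.im (show s - 2 = 1 from h)
    simp [him] at h3
  have h3 : AnalyticAt ℂ (fun s => ∏ n ∈ Finset.range K, zetaFactor n (s - 1)) s := by
    refine Finset.analyticAt_fun_prod _ fun n _ => ?_
    exact ((analyticAt_zeta_natCast_mul_sub_one (hne _)).pow _).mul
      (((analyticAt_zeta_natCast_mul_sub_one (hne _)).div
        (analyticAt_zeta_natCast_mul_sub_one (hne _)) (hz _ (Nat.succ_pos n))).pow _)
  exact (((h0.mul h1).mul h2).mul h3).mul (analyticAt_tprod_clearedEulerFactor hs)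

/-- The continuation to `Re s > 1`; `K` is chosen so that `s` lies in `clearedHalfPlane K`. -/
noncomputable def cubeSeriesContinuation (s : ℂ) : ℂ := cubeContinuation ⌈1 / (s.re - 1)⌉₊ s

theorem mem_clearedHalfPlane_ceil {s : ℂ} (hs : 1 < s.re) :
    s ∈ clearedHalfPlane ⌈1 / (s.re - 1)⌉₊ := by
  have h0 : 0 < s.re - 1 := by linarith
  have h1 := Nat.le_ceil (1 / (s.re - 1))
  rw [div_le_iff₀ h0] at h1
  change 1 < ((⌈1 / (s.re - 1)⌉₊ : ℝ) + 1) * (s.re - 1)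
  linarith

theorem cubeSeriesContinuation_eq {K : ℕ} {s : ℂ} (hs : s ∈ clearedHalfPlane K) :
    cubeSeriesContinuation s = cubeContinuation K s := by
  have h1 := mem_clearedHalfPlane_ceil (one_lt_re_of_mem_clearedHalfPlane hs)
  rcases le_total K ⌈1 / (s.re - 1)⌉₊ with h | h
  · exact cubeContinuation_eq_of_le h hs
  · exact (cubeContinuation_eq_of_le h h1).symm

theorem cubeSeriesContinuation_eventuallyEq {K : ℕ} {s : ℂ} (hs : s ∈ clearedHalfPlane K) :
    cubeSeriesContinuation =ᶠ[nhds s] cubeContinuation K := by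
  filter_upwards [(isOpen_clearedHalfPlane K).mem_nhds hs] with t ht
  exact cubeSeriesContinuation_eq ht

theorem meromorphicOn_cubeSeriesContinuation :
    MeromorphicOn cubeSeriesContinuation {s : ℂ | 1 < s.re} := by
  intro s hs
  have h := mem_clearedHalfPlane_ceil hs
  exact (meromorphicAt_cubeContinuation h).congr
    ((cubeSeriesContinuation_eventuallyEq h).symm.filter_mono nhdsWithin_le_nhds)

theorem cubeSeriesContinuation_eq_of_two_lt_re {s : ℂ} (hs : 2 < s.re) :
    cubeSeriesContinuation s = riemannZeta s * riemannZeta (s - 1) * riemannZeta (s - 2) *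
      ∏' p : Nat.Primes, cubeEulerFactor s p := by
  have h : s ∈ clearedHalfPlane 0 := by
    change 1 < (((0 : ℕ) : ℝ) + 1) * (s.re - 1)
    push_cast
    linarith
  rw [cubeSeriesContinuation_eq h, cubeContinuation]
  simp [clearedEulerFactor]

/-- A zero of one Euler factor is a zero of the continuation, unless it is compensated by a zero of
`ζ (j (s - 1))` for some `j`. -/
theorem analyticAt_and_eq_zero_of_cubeEulerFactor_eq_zero {s : ℂ} (hs : 1 < s.re)
    (him : s.im ≠ 0) (hz : ∀ j : ℕ, 0 < j → riemannZeta ((j : ℂ) * (s - 1)) ≠ 0) {p : Nat.Primes}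
    (hp : cubeEulerFactor s p = 0) :
    AnalyticAt ℂ cubeSeriesContinuation s ∧ cubeSeriesContinuation s = 0 := by
  have h := mem_clearedHalfPlane_ceil hs
  refine ⟨(analyticAt_cubeContinuation h him hz).congr
    (cubeSeriesContinuation_eventuallyEq h).symm, ?_⟩
  rw [cubeSeriesContinuation_eq h, cubeContinuation, tprod_of_exists_eq_zero, mul_zero]
  exact ⟨p, by rw [clearedEulerFactor, hp, zero_mul]⟩

/-! ### Zeros of Euler factors and the natural boundary -/

/-- The larger root of `β² - 2 (1 + 1/x) β + 1/x`. For a prime `x = p` it is the number `β` such that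
the Euler factor at `p` vanishes when `p ^ (s - 1) = -β`. -/
noncomputable def eulerRoot (x : ℝ) : ℝ := 1 + 1 / x + √(1 + 1 / x + (1 / x) ^ 2)

theorem two_lt_eulerRoot {x : ℝ} (hx : 0 < x) : 2 < eulerRoot x := by
  have h : 0 < 1 / x := by positivity
  have h1 : 1 ≤ √(1 + 1 / x + (1 / x) ^ 2) := Real.one_le_sqrt.2 (by nlinarith)
  rw [eulerRoot]
  linarith

theorem eulerRoot_anti {x y : ℝ} (hx : 0 < x) (hxy : x ≤ y) : eulerRoot y ≤ eulerRoot x := by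
  have hy : 0 < y := hx.trans_le hxy
  have h : 1 / y ≤ 1 / x := one_div_le_one_div_of_le hx hxy
  have h0 : 0 ≤ 1 / y := by positivity
  unfold eulerRoot
  gcongr

theorem eulerRoot_le_four {x : ℝ} (hx : 2 ≤ x) : eulerRoot x ≤ 4 := by
  refine (eulerRoot_anti two_pos hx).trans ?_
  have : √(1 + 1 / 2 + (1 / 2) ^ 2) ≤ 2 := by
    rw [Real.sqrt_le_left (by norm_num)]
    norm_num
  rw [eulerRoot]
  linarith

theorem eulerRoot_eq {x : ℝ} (hx : 0 < x) :
    eulerRoot x ^ 2 - 2 * (1 + 1 / x) * eulerRoot x + 1 / x = 0 := by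
  have h : 0 < 1 / x := by positivity
  have h1 : √(1 + 1 / x + (1 / x) ^ 2) ^ 2 = 1 + 1 / x + (1 / x) ^ 2 :=
    Real.sq_sqrt (by positivity)
  rw [eulerRoot]
  linear_combination h1

theorem cubeEulerFactor_eq_zero {s : ℂ} {p : Nat.Primes}
    (h : ((p : ℕ) : ℂ) ^ (1 - s) = -((eulerRoot (p : ℕ) : ℝ) : ℂ)⁻¹) : cubeEulerFactor s p = 0 := by
  have hp0 : (0 : ℝ) < (p : ℕ) := by exact_mod_cast p.2.pos
  have hp0' : ((p : ℕ) : ℂ) ≠ 0 := by exact_mod_cast p.2.ne_zero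
  have hβ : ((eulerRoot (p : ℕ) : ℝ) : ℂ) ≠ 0 := by
    exact_mod_cast ((zero_lt_two).trans (two_lt_eulerRoot hp0)).ne'
  have e := congrArg (fun x : ℝ => (x : ℂ)) (eulerRoot_eq hp0)
  push_cast at e
  rw [cubeEulerFactor_eq, h]
  field_simp at e ⊢
  linear_combination e

/-- Each Euler factor has a zero near every point of the line `Re s = 1`, at a distance
`O(1 / log p)`. -/
theorem exists_cubeEulerFactor_eq_zero (t : ℝ) (p : Nat.Primes) :
    ∃ s : ℂ, cubeEulerFactor s p = 0 ∧ s.im ≠ 0 ∧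
      (s.re - 1) * Real.log (p : ℕ) = Real.log (eulerRoot (p : ℕ)) ∧
      |s.im - t| * Real.log (p : ℕ) ≤ Real.pi := by
  have hp0 : (0 : ℝ) < (p : ℕ) := by exact_mod_cast p.2.pos
  have hlog : 0 < Real.log (p : ℕ) := Real.log_pos (by exact_mod_cast p.2.one_lt)
  have hβ : 0 < eulerRoot (p : ℕ) := (zero_lt_two).trans (two_lt_eulerRoot hp0)
  have hpi := Real.pi_pos
  set L := Real.log (p : ℕ) with hL
  set m : ℤ := ⌊t * L / (2 * Real.pi)⌋ with hm
  set y : ℝ := Real.pi * (2 * m + 1) / L with hy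
  have hyL : y * L = Real.pi * (2 * m + 1) := div_mul_cancel₀ _ hlog.ne'
  set x : ℝ := Real.log (eulerRoot (p : ℕ)) / L with hx
  have hxL : x * L = Real.log (eulerRoot (p : ℕ)) := div_mul_cancel₀ _ hlog.ne'
  refine ⟨⟨1 + x, y⟩, ?_, ?_, ?_, ?_⟩
  · apply cubeEulerFactor_eq_zero
    have hp0' : ((p : ℕ) : ℂ) ≠ 0 := by exact_mod_cast p.2.ne_zero
    rw [Complex.cpow_def_of_ne_zero hp0', ← Complex.natCast_log, ← hL]
    have e : (L : ℂ) * (1 - ⟨1 + x, y⟩) =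
        ((-Real.log (eulerRoot (p : ℕ)) : ℝ) : ℂ) +
          ((-(m + 1) : ℤ) : ℂ) * (2 * Real.pi * Complex.I) + Real.pi * Complex.I := by
      rw [← hxL]
      apply Complex.ext
      · simp
        ring
      · simp
        linear_combination -hyL
    rw [e, Complex.exp_add, Complex.exp_add, Complex.exp_pi_mul_I,
      Complex.exp_int_mul_two_pi_mul_I, ← Complex.ofReal_exp, Real.exp_neg, Real.exp_log hβ]
    push_cast
    ring
  · intro h
    have h : y = 0 := h
    rw [h, zero_mul] at hyL
    have h2 : (2 * (m : ℝ) + 1) = 0 := by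
      rcases mul_eq_zero.1 hyL.symm with h3 | h3
      · exact absurd h3 hpi.ne'
      · exact h3
    have h3 : 2 * m + 1 = 0 := by exact_mod_cast h2
    omega
  · change (1 + x - 1) * L = _
    rw [add_sub_cancel_left, hxL]
  · change |y - t| * L ≤ Real.pi
    rw [← abs_of_pos hlog, ← abs_mul, sub_mul, hyL, abs_le]
    have h1 := Int.floor_le (t * L / (2 * Real.pi))
    have h2 := Int.lt_floor_add_one (t * L / (2 * Real.pi))
    rw [← hm, le_div_iff₀ (by positivity)] at h1
    rw [← hm, div_lt_iff₀ (by positivity)] at h2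
    constructor <;> nlinarith

/-- The series `∑ 2 ^ (-j)` over all pairs of a natural number `j` and a zero of `ζ` of height at
most `c j` converges, by the polynomial bound for the number of zeros. -/
theorem summable_half_pow_zetaZerosUpTo {c : ℝ} (hc : 0 ≤ c) :
    Summable fun x : (j : ℕ) × zetaZerosUpTo (c * j) => (1 / 2 : ℝ) ^ x.1 := by
  obtain ⟨A, hA, h⟩ := exists_ncard_zetaZerosUpTo_le
  rw [summable_sigma_of_nonneg fun _ => by positivity]
  have hfin : ∀ j : ℕ, Finite (zetaZerosUpTo (c * j)) := fun j => finite_zetaZerosUpTo _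
  refine ⟨fun j => Summable.of_finite, ?_⟩
  have hs : ∀ k : ℕ, Summable fun j : ℕ => (j : ℝ) ^ k * (1 / 2 : ℝ) ^ j := fun k =>
    summable_pow_mul_geometric_of_norm_lt_one k (by norm_num)
  refine Summable.of_nonneg_of_le (fun j => tsum_nonneg fun _ => by positivity) (fun j => ?_)
    ((((hs 2).mul_left (c ^ 2)).add ((hs 1).mul_left (2 * c))).add (hs 0) |>.mul_left A)
  change ∑' _ : zetaZerosUpTo (c * j), (1 / 2 : ℝ) ^ j ≤ _
  rw [tsum_const, nsmul_eq_mul]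
  have h1 := h (c * j) (by positivity)
  rw [← Nat.card_coe_set_eq] at h1
  calc (Nat.card (zetaZerosUpTo (c * j)) : ℝ) * (1 / 2 : ℝ) ^ j
      ≤ (A * (c * j + 1) ^ 2) * (1 / 2 : ℝ) ^ j := by gcongr
    _ = _ := by ring

/-- Near every point of the line `Re s = 1` there is a zero of an Euler factor that is not
compensated by a zero of `ζ (j (s - 1))` for any `j`. Otherwise every large prime `p` would give,
through a zero `s` of its Euler factor with `p ^ (Re s - 1) > 2`, a zero `ρ = j (s - 1)` of `ζ` with
`p > 2 ^ j`; as `(j, ρ)` determines `p`, the sum of the reciprocals of the primes would converge. -/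
theorem exists_cubeEulerFactor_eq_zero_and_riemannZeta_ne_zero (t : ℝ) {ε : ℝ} (hε : 0 < ε) :
    ∃ (p : Nat.Primes) (s : ℂ), cubeEulerFactor s p = 0 ∧ 1 < s.re ∧ s.im ≠ 0 ∧
      (∀ j : ℕ, 0 < j → riemannZeta ((j : ℂ) * (s - 1)) ≠ 0) ∧ |s.re - 1| < ε ∧ |s.im - t| < ε := by
  by_contra! hcon
  choose s hs0 him hre hti using exists_cubeEulerFactor_eq_zero t
  set c : ℝ := |t| + ε with hc
  have hlog0 : ∀ p : Nat.Primes, 0 < Real.log (p : ℕ) := fun p =>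
    Real.log_pos (by exact_mod_cast p.2.one_lt)
  have hp0 : ∀ p : Nat.Primes, (0 : ℝ) < (p : ℕ) := fun p => by exact_mod_cast p.2.pos
  have hre1 : ∀ p, 0 < (s p).re - 1 := by
    intro p
    have h1 := Real.log_pos (one_lt_two.trans (two_lt_eulerRoot (hp0 p)))
    rw [← hre p] at h1
    exact pos_of_mul_pos_left h1 (hlog0 p).le
  -- The exceptional set of small primes, where the zero may be too far from the line.
  set N : Set Nat.Primes := {p | Real.log (p : ℕ) ≤ 4 / ε} with hN
  have hNfin : N.Finite := by
    have h1 : (Subtype.val '' N : Set ℕ).Finite := by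
      refine (Set.finite_le_nat ⌈Real.exp (4 / ε)⌉₊).subset ?_
      rintro _ ⟨p, hp, rfl⟩
      have h2 : ((p : ℕ) : ℝ) ≤ Real.exp (4 / ε) := (Real.log_le_iff_le_exp (hp0 p)).1 hp
      exact_mod_cast h2.trans (Nat.le_ceil _)
    exact h1.of_finite_image Subtype.val_injective.injOn
  have hbig : ∀ p : ↑Nᶜ, ∃ j : ℕ, 0 < j ∧ riemannZeta ((j : ℂ) * (s p - 1)) = 0 ∧
      |(s p).im| ≤ c := by
    rintro ⟨p, hp⟩
    have hp' : 4 / ε < Real.log (p : ℕ) := not_le.1 hp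
    rw [div_lt_iff₀ hε] at hp'
    have hp2 : (2 : ℝ) ≤ (p : ℕ) := by exact_mod_cast p.2.two_le
    have h1 : |(s p).re - 1| < ε := by
      rw [abs_of_pos (hre1 p)]
      have h2 : Real.log (eulerRoot (p : ℕ)) ≤ 4 := by
        have h3 := Real.log_le_sub_one_of_pos (zero_lt_two.trans (two_lt_eulerRoot (hp0 p)))
        linarith [eulerRoot_le_four hp2]
      rw [← hre p] at h2
      by_contra! h3
      nlinarith [mul_le_mul_of_nonneg_right h3 (hlog0 p).le]
    have h2 : |(s p).im - t| < ε := by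
      by_contra! h3
      nlinarith [mul_le_mul_of_nonneg_right h3 (hlog0 p).le, Real.pi_lt_four, hti p]
    by_contra! h3
    have h4 := hcon p (s p) (hs0 p) (by linarith [hre1 p]) (him p) ?_ h1
    · exact absurd h2 (not_lt.2 h4)
    · intro j hj h5
      have h6 := h3 j hj h5
      have h7 : |(s p).im| ≤ |t| + |(s p).im - t| := by
        calc |(s p).im| = |t + ((s p).im - t)| := by ring_nf
          _ ≤ _ := abs_add_le _ _
      rw [hc] at h6
      linarith
  choose j hj hzero himc using hbig
  have hmem : ∀ p : ↑Nᶜ, (j p : ℂ) * (s p - 1) ∈ zetaZerosUpTo (c * j p) := by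
    intro p
    have hjp : (0 : ℝ) < j p := by exact_mod_cast hj p
    refine ⟨hzero p, ?_, ?_⟩
    · rw [← Complex.ofReal_natCast, Complex.re_ofReal_mul]
      have : (s p - 1).re = (s p).re - 1 := by simp
      rw [this]
      exact mul_pos hjp (hre1 p)
    · rw [← Complex.ofReal_natCast, Complex.im_ofReal_mul, abs_mul, abs_of_pos hjp, mul_comm]
      have : (s p - 1).im = (s p).im := by simp
      rw [this]
      gcongr
      exact himc p
  set Φ : ↑Nᶜ → (k : ℕ) × zetaZerosUpTo (c * k) := fun p => ⟨j p, _, hmem p⟩ with hΦ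
  -- `log (eulerRoot p) / log p` is strictly decreasing in `p`.
  have hs_inj : ∀ p q : Nat.Primes, s p = s q → (q : ℕ) ≤ p := by
    intro p q hpq
    by_contra! hlt
    have h1 : ((p : ℕ) : ℝ) < (q : ℕ) := by exact_mod_cast hlt
    have h2 := Real.log_lt_log (hp0 p) h1
    have h3 : Real.log (eulerRoot (q : ℕ)) ≤ Real.log (eulerRoot (p : ℕ)) :=
      Real.log_le_log (zero_lt_two.trans (two_lt_eulerRoot (hp0 q))) (eulerRoot_anti (hp0 p) h1.le)
    rw [← hre p, ← hre q, ← hpq] at h3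
    nlinarith [hre1 p]
  have hΦinj : Function.Injective Φ := by
    intro p q hpq
    have h1 : j p = j q := congrArg Sigma.fst hpq
    have h2 : (j p : ℂ) * (s p - 1) = (j q : ℂ) * (s q - 1) :=
      congrArg (fun x : (k : ℕ) × zetaZerosUpTo (c * k) => (x.2 : ℂ)) hpq
    have h3 : (j q : ℂ) ≠ 0 := by exact_mod_cast (hj q).ne'
    rw [h1] at h2
    have h4 : s p = s q := by
      have := mul_left_cancel₀ h3 h2
      linear_combination this
    exact Subtype.ext (Subtype.ext (le_antisymm (hs_inj q p h4.symm) (hs_inj p q h4)))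
  have hsum := (summable_half_pow_zetaZerosUpTo (c := c) (by positivity)).comp_injective hΦinj
  have hle : ∀ p : ↑Nᶜ, (1 / ((p : Nat.Primes) : ℕ) : ℝ) ≤ (1 / 2 : ℝ) ^ (j p) := by
    intro p
    have hjp : (0 : ℝ) < j p := by exact_mod_cast hj p
    have h1 : (j p : ℝ) * ((s p).re - 1) < 1 := by
      by_contra! h
      refine riemannZeta_ne_zero_of_one_le_re (s := (j p : ℂ) * (s p - 1)) ?_ (hzero p)
      rw [← Complex.ofReal_natCast, Complex.re_ofReal_mul]
      simpa using h
    have h2 : (j p : ℝ) * Real.log 2 < Real.log ((p : Nat.Primes) : ℕ) := by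
      have h3 : Real.log 2 < Real.log (eulerRoot ((p : Nat.Primes) : ℕ)) :=
        Real.log_lt_log zero_lt_two (two_lt_eulerRoot (hp0 p))
      calc (j p : ℝ) * Real.log 2 < j p * Real.log (eulerRoot ((p : Nat.Primes) : ℕ)) := by gcongr
        _ = (j p * ((s p).re - 1)) * Real.log ((p : Nat.Primes) : ℕ) := by rw [← hre p]; ring
        _ < 1 * Real.log ((p : Nat.Primes) : ℕ) := by
            gcongr
            exact hlog0 p
        _ = _ := one_mul _
    rw [← Real.log_pow] at h2
    have h3 : (2 : ℝ) ^ (j p) < ((p : Nat.Primes) : ℕ) :=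
      (Real.log_lt_log_iff (by positivity) (hp0 p)).1 h2
    rw [one_div_pow]
    exact one_div_le_one_div_of_le (by positivity) h3.le
  have hsum2 : Summable ((fun p : Nat.Primes => (1 / (p : ℕ) : ℝ)) ∘ ((↑) : ↑Nᶜ → Nat.Primes)) :=
    Summable.of_nonneg_of_le (fun p => by simp) hle hsum
  exact Nat.Primes.not_summable_one_div (hNfin.summable_compl_iff.1 hsum2)

open Filter Topology in
/-- A criterion for a natural boundary: every point of the line is a limit of zeros of `F`. A
meromorphic extension would have to vanish identically, hence so would `F`. -/
theorem hasNaturalBoundaryAtRe_of_zeros {F : ℂ → ℂ} {a : ℝ} (hF : MeromorphicOn F {s | a < s.re})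
    {x : ℂ} (hxa : a < x.re) (hxc : ContinuousAt F x) (hx : F x ≠ 0)
    (hzeros : ∀ z : ℂ, z.re = a → ∀ V ∈ 𝓝 z, ∃ s ∈ V, a < s.re ∧ ContinuousAt F s ∧ F s = 0) :
    HasNaturalBoundaryAtRe F a := by
  intro z hz U hU hzU g hg heq
  have hH : IsOpen {s : ℂ | a < s.re} := isOpen_lt continuous_const Complex.continuous_re
  have hnear : ∀ s ∈ U, a < s.re → F =ᶠ[𝓝[≠] s] g := by
    intro s hs hsa
    have h1 := mem_codiscreteWithin_iff_forall_mem_nhdsNE.1 heq s ⟨hs, hsa⟩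
    have h2 : U ∩ {s : ℂ | a < s.re} ∈ 𝓝[≠] s :=
      mem_nhdsWithin_of_mem_nhds ((hU.inter hH).mem_nhds ⟨hs, hsa⟩)
    filter_upwards [h1, h2] with t ht1 ht2
    rcases ht1 with h | h
    · exact h
    · exact absurd ht2 h
  have hlift : ∀ {P : ℂ → Prop}, (∀ᶠ s in 𝓝[≠] z, P s) →
      ∃ V ∈ 𝓝 z, ∀ s ∈ V, a < s.re → s ∈ U ∧ ∀ᶠ t in 𝓝 s, P t := by
    intro P hP
    rw [eventually_nhdsWithin_iff] at hP
    have h1 := hP.eventually_nhds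
    refine ⟨{s | (∀ᶠ t in 𝓝 s, t ∈ ({z} : Set ℂ)ᶜ → P t) ∧ s ∈ U},
      h1.and (hU.mem_nhds hzU), fun s hs hsa => ⟨hs.2, ?_⟩⟩
    have hsz : s ≠ z := by
      rintro rfl
      exact hsa.ne' hz
    filter_upwards [hs.1, isOpen_ne.mem_nhds hsz] with t ht htz using ht htz
  have hgz := hg z hzU
  rcases hgz.eventually_eq_zero_or_eventually_ne_zero with h0 | hne
  · obtain ⟨V, hV, h⟩ := hlift h0
    obtain ⟨s, hsV, hsa, -, -⟩ := hzeros z hz V hV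
    obtain ⟨hsU, hs⟩ := h s hsV hsa
    have h1 : meromorphicOrderAt F s = ⊤ := by
      rw [meromorphicOrderAt_eq_top_iff]
      filter_upwards [hnear s hsU hsa, hs.filter_mono nhdsWithin_le_nhds] with t h2 h3
      rw [h2, h3]
    refine hF.meromorphicOrderAt_ne_top_of_isPreconnected
      (convex_halfSpace_re_gt a).isPreconnected (x := x) hxa hsa ?_ h1
    rw [Ne, meromorphicOrderAt_eq_top_iff]
    intro h2
    have h3 := hxc.eventually_ne hx
    obtain ⟨t, ht1, ht2⟩ := (h2.and (h3.filter_mono nhdsWithin_le_nhds)).exists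
    exact ht2 ht1
  · obtain ⟨V, hV, h⟩ := hlift (hne.and hgz.eventually_analyticAt)
    obtain ⟨s, hsV, hsa, hsc, hs0⟩ := hzeros z hz V hV
    obtain ⟨hsU, hs⟩ := h s hsV hsa
    obtain ⟨hgs, hgan⟩ := hs.self_of_nhds
    have h1 : Tendsto F (𝓝[≠] s) (𝓝 (F s)) := hsc.tendsto.mono_left nhdsWithin_le_nhds
    have h2 : Tendsto g (𝓝[≠] s) (𝓝 (g s)) :=
      hgan.continuousAt.tendsto.mono_left nhdsWithin_le_nhds
    have h3 := tendsto_nhds_unique (h1.congr' (hnear s hsU hsa)) h2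
    exact hgs (h3.symm.trans hs0)

open Filter Topology in
theorem hasNaturalBoundaryAtRe_cubeSeriesContinuation {x : ℂ} (hx1 : 1 < x.re)
    (hxc : ContinuousAt cubeSeriesContinuation x) (hx : cubeSeriesContinuation x ≠ 0) :
    HasNaturalBoundaryAtRe cubeSeriesContinuation 1 := by
  refine hasNaturalBoundaryAtRe_of_zeros meromorphicOn_cubeSeriesContinuation hx1 hxc hx ?_
  intro z hz V hV
  obtain ⟨ε, hε, hball⟩ := Metric.mem_nhds_iff.1 hV
  obtain ⟨p, s, hs0, hs1, him, hzeta, hre, hti⟩ :=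
    exists_cubeEulerFactor_eq_zero_and_riemannZeta_ne_zero z.im (half_pos hε)
  obtain ⟨han, h0⟩ := analyticAt_and_eq_zero_of_cubeEulerFactor_eq_zero hs1 him hzeta hs0
  refine ⟨s, hball ?_, hs1, han.continuousAt, h0⟩
  rw [Metric.mem_ball, dist_eq_norm]
  refine (Complex.norm_le_abs_re_add_abs_im _).trans_lt ?_
  rw [Complex.sub_re, Complex.sub_im, hz]
  linarith

open ArithmeticFunction ArithmeticFunction.sigma in
theorem cubeSeriesContinuation_eq_lseries {a : ℕ → ℕ}
    (ha : ∀ n : ℕ, 0 < n → ∑ d ∈ n.divisors, d * a d = (σ 1 n) ^ 3) {s : ℂ} (hs : 3 < s.re) :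
    cubeSeriesContinuation s = LSeries (fun n => (a n : ℂ)) s := by
  rw [lseries_eq_zeta_mul_tprod_cubeEulerFactor ha hs,
    cubeSeriesContinuation_eq_of_two_lt_re (by linarith)]

open ArithmeticFunction ArithmeticFunction.sigma Filter in
theorem exists_continuousAt_cubeSeriesContinuation_ne_zero {a : ℕ → ℕ}
    (ha : ∀ n : ℕ, 0 < n → ∑ d ∈ n.divisors, d * a d = (σ 1 n) ^ 3) :
    ∃ x : ℂ, 1 < x.re ∧ ContinuousAt cubeSeriesContinuation x ∧ cubeSeriesContinuation x ≠ 0 := by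
  have habs : LSeries.abscissaOfAbsConv (fun n => (a n : ℂ)) ≤ ((3 : ℝ) : EReal) :=
    LSeries.abscissaOfAbsConv_le_of_forall_lt_LSeriesSummable fun y hy =>
      lseriesSummable_of_sum_mul_eq_sigma_cube ha (by simpa using hy)
  have h1 : a 1 = 1 := by simpa using ha 1 one_pos
  have ht := LSeries.tendsto_atTop (habs.trans_lt (EReal.coe_lt_top 3))
  rw [h1, Nat.cast_one] at ht
  obtain ⟨x, hx, hx3⟩ := ((ht.eventually_ne one_ne_zero).and (eventually_gt_atTop 3)).exists
  have hx3' : 3 < (x : ℂ).re := by simpa using hx3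
  refine ⟨x, by linarith, ?_, by rwa [cubeSeriesContinuation_eq_lseries ha hx3']⟩
  have han := (LSeries_analyticOnNhd (fun n => (a n : ℂ))) (x : ℂ)
    (habs.trans_lt (EReal.coe_lt_coe_iff.2 hx3'))
  refine han.continuousAt.congr ?_
  filter_upwards [(isOpen_lt continuous_const Complex.continuous_re).mem_nhds hx3'] with t ht
  exact (cubeSeriesContinuation_eq_lseries ha ht).symm

theorem mainTheorem4 {X : Type*} (T : X → X)
    (hfin : ∀ n : ℕ, 1 ≤ n → (closedOrbits T n).Finite) :
    ((∀ s : ℂ, 1 < s.re → orbitDirichletSeries T s = riemannZeta s) ↔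
      ∀ n : ℕ, 1 ≤ n → orbitCount T n = 1) ∧
    ((∀ s : ℂ, 1 < s.re → orbitDirichletSeries T s = riemannZeta s) →
      (∀ n : ℕ, 1 ≤ n → (closedOrbits (cartesianCube T) n).Finite) ∧
      abscissaOfConvergence (orbitCoeff (cartesianCube T)) = 3 ∧
      (∀ s : ℂ, 3 < s.re →
        LSeriesSummable (orbitCoeff (cartesianCube T)) s ∧
        Multipliable (cubeEulerFactor s) ∧
        orbitDirichletSeries (cartesianCube T) s =
          riemannZeta s * riemannZeta (s - 1) * riemannZeta (s - 2) *
            ∏' p : Nat.Primes, cubeEulerFactor s p) ∧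
      ∃ F : ℂ → ℂ,
        MeromorphicOn F {s : ℂ | 1 < s.re} ∧
        (∀ s : ℂ, 3 < s.re → F s = orbitDirichletSeries (cartesianCube T) s) ∧
        HasNaturalBoundaryAtRe F 1) := by
  refine ⟨orbitDirichletSeries_eq_zeta_iff T, fun h => ?_⟩
  have hone := (orbitDirichletSeries_eq_zeta_iff T).1 h
  have ha : ∀ n : ℕ, 0 < n → ∑ d ∈ n.divisors, d * orbitCount (cartesianCube T) d =
      (ArithmeticFunction.sigma 1 n) ^ 3 := by
    intro n hn
    rw [sum_mul_orbitCount_cartesianCube T hfin hone hn, ArithmeticFunction.sigma_one_apply]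
  have hsum : ∀ s : ℂ, 3 < s.re → LSeriesSummable (orbitCoeff (cartesianCube T)) s :=
    fun s hs => lseriesSummable_of_sum_mul_eq_sigma_cube ha hs
  obtain ⟨x, hx1, hxc, hx⟩ := exists_continuousAt_cubeSeriesContinuation_ne_zero ha
  exact ⟨fun n hn => finite_closedOrbits_cartesianCube T hfin hn,
    abscissaOfConvergence_eq_three
      (fun n hn => sq_le_orbitCount_cartesianCube T hfin hone hn) hsum,
    fun s hs => ⟨hsum s hs, multipliable_cubeEulerFactor (by linarith),
      lseries_eq_zeta_mul_tprod_cubeEulerFactor ha hs⟩,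
    cubeSeriesContinuation, meromorphicOn_cubeSeriesContinuation,
    fun s hs => cubeSeriesContinuation_eq_lseries ha hs,
    hasNaturalBoundaryAtRe_cubeSeriesContinuation hx1 hxc hx⟩
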